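/- Let $X=(X_1,X_2,\dots)$ and $Y=(Y_1,Y_2,\dots)$ be two infinite sequences of commuting variables. All infinite sums and products below are taken coefficientwise in the ring $\mathbb{Q}[[X,Y]]$ of formal power series in these variables. Put $$Q_X(z)=\prod_{i\ge 1}\frac{1+X_iz}{1-X_iz}=\sum_{n\ge 0}q_n(X)z^n ,$$ and define $Q_Y(z)$ likewise. Identify a strict partition $\lambda=(\lambda_1>\dots>\lambda_\ell>0)$ with the finite set $\{\lambda_1,\dots,\lambda_\ell\}$ of positive integers, and write $\ell=\ell(\lambda)$. Let $\mathcal D$ be the set of all strict partitions. The Schur $Q$-function $Q_\lambda(X)$ is the coefficient of $z_1^{\lambda_1}\cdots z_\ell^{\lambda_\ell}$ in $$\prod_{i=1}^{\ell}Q_X(z_i)\prod_{1\le i<j\le \ell}\frac{z_i-z_j}{z_i+z_j},\qquad \frac{z_i-z_j}{z_i+z_j}:=1+2\sum_{n\ge 1}(-1)^n z_i^{-n}z_j^{n},$$ and $P_\lambda=2^{-\ell(\lambda)}Q_\lambda$. Let $Z=\sum_{\lambda\in\mathcal D}Q_\lambda(X)P_\lambda(Y)$. The (formal) shifted Schur measure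 of a set $S\subseteq\mathcal D$ is $\mathrm P_{\mathrm{SS}}(S)=\sum_{\lambda\in S}Z^{-1}Q_\lambda(X)P_\lambda(Y)$, and its correlation function at a finite set $A$ of positive integers is $$\rho_{\mathrm{SS}}(A)=\mathrm P_{\mathrm{SS}}(\{\lambda\in\mathcal D:\lambda\supseteq A\}).$$ Let $\mathbb J(z)=Q_X(z)\,Q_Y(-z^{-1})$, a formal series in integer powers of $z$. For nonzero integers $u,v$, not with $u<0<v$, let $\mathbb K(u,v)$ be $\epsilon(u,v)$ times the coefficient of $z^uw^v$ in the formal series $$\tfrac12\,\mathbb J(z)\,\mathbb J(w)\,\frac{z-w}{z+w},\qquad \frac{z-w}{z+w}:=1+2\sum_{n\ge1}(-1)^nz^{-n}w^n,$$ where $\epsilon(u,v)=1$ if $u,v>0$, $\epsilon(u,v)=(-1)^v$ if $u>0>v$, and $\epsilon(u,v)=(-1)^{u+v}$ if $u,v<0$. **Theorem.** The series $Z$ and the series defining each $Q_\lambda$, each coefficient of $\mathbb J(z)$ and each coefficient of $\mathbb J(z)\mathbb J(w)\frac{z-w}{z+w}$ converge coefficientwise, and $Z$ is invertible in $\mathbb{Q}[[X,Y]]$.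 For every $N\ge 0$ and every set $A=\{k_1,\dots,k_N\}$ of $N$ distinct positive integers (listed in any order), $$\rho_{\mathrm{SS}}(A)=\mathrm{Pf}\,(M(A)_{i,j})_{1\le i<j\le 2N},$$ where $M(A)$ is the skew symmetric $2N\times 2N$ matrix with $$M(A)_{i,j}=\begin{cases}\mathbb K(k_i,k_j), & 1\le i<j\le N,\\ \mathbb K(k_i,-k_{2N-j+1}), & 1\le i\le N<j\le 2N,\\ \mathbb K(-k_{2N-i+1},-k_{2N-j+1}), & N<i<j\le 2N.\end{cases}$$ -/

import Mathlib

open scoped MvPowerSeries.WithPiTopology PowerSeries.WithPiTopology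

namespace ShiftedSchur

noncomputable section

/-- Formal power series over `ℚ` in the two infinite alphabets `X = (X_i)` (indices `Sum.inl i`)
and `Y = (Y_i)` (indices `Sum.inr i`). It carries the topology of coefficientwise convergence, in
which all infinite sums and products below are taken. -/
abbrev SeriesXY : Type := MvPowerSeries (ℕ ⊕ ℕ) ℚ

/-- The variable `X_i`. -/
def varX (i : ℕ) : SeriesXY := MvPowerSeries.X (Sum.inl i)

/-- The variable `Y_i`. -/
def varY (i : ℕ) : SeriesXY := MvPowerSeries.X (Sum.inr i)

/-- The power series `(1 + x z) / (1 - x z)` in `z`. -/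
def factor (x : SeriesXY) : PowerSeries SeriesXY :=
  (1 + PowerSeries.C x * PowerSeries.X) *
    PowerSeries.invOfUnit (1 - PowerSeries.C x * PowerSeries.X) 1

/-- `Q_x(z) = ∏_i (1 + x_i z) / (1 - x_i z)`, a power series in `z`; its coefficient of `z ^ n` is
`q_n(x)`. -/
def genQ (x : ℕ → SeriesXY) : PowerSeries SeriesXY := ∏' i, factor (x i)

/-- The coefficient of `z ^ n`, for an integer `n`, in a power series in `z`. -/
def coeffInt (F : PowerSeries SeriesXY) (n : ℤ) : SeriesXY :=
  if 0 ≤ n then PowerSeries.coeff n.toNat F else 0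

/-- The coefficient of `t ^ n` in `(1 - t) / (1 + t)`. Thus the coefficient of `z ^ (-n) * w ^ n` in
`(z - w) / (z + w)`, expanded in powers of `t = w / z` (the region `|z| > |w|`), is `kernelCoeff n`,
and all other coefficients vanish. -/
def kernelCoeff (n : ℕ) : ℚ :=
  PowerSeries.coeff n ((1 - PowerSeries.X) * (1 + PowerSeries.X : PowerSeries ℚ)⁻¹)

/-- Strict partitions, identified with finite sets of positive integers. -/
abbrev StrictPartition : Type := Finset ℕ+

/-- The parts `λ_0 > λ_1 > ⋯` of a strict partition in decreasing order. -/
def part (lam : StrictPartition) (i : Fin lam.card) : ℤ :=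
  ((lam.orderEmbOfFin rfl i.rev : ℕ+) : ℤ)

/-- The pairs `i < j` of indices in `Fin m`. -/
abbrev Pairs (m : ℕ) : Type := {p : Fin m × Fin m // p.1 < p.2}

/-- A term of the Cauchy product expressing the coefficient of `∏ i, z_i ^ (l i)` in
`(∏ i, Q_x(z_i)) * ∏_{i < j} (z_i - z_j) / (z_i + z_j)`: from the factor of the pair `i < j` one
picks the monomial `z_i ^ (-a (i, j)) * z_j ^ (a (i, j))`, so that the exponent left over for
`Q_x(z_i)` is `l i + ∑_{j > i} a (i, j) - ∑_{j < i} a (j, i)`. -/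
def schurQTerm (x : ℕ → SeriesXY) {m : ℕ} (l : Fin m → ℤ) (a : Pairs m → ℕ) : SeriesXY :=
  (∏ p : Pairs m, MvPowerSeries.C (kernelCoeff (a p))) *
    ∏ i : Fin m, coeffInt (genQ x)
      (l i + (∑ p : Pairs m, if p.1.1 = i then (a p : ℤ) else 0)
        - ∑ p : Pairs m, if p.1.2 = i then (a p : ℤ) else 0)

/-- The Schur `Q`-function `Q_λ(x)`: the coefficient of `z_1 ^ λ_1 ⋯ z_m ^ λ_m`, `m = ℓ(λ)`, in
`(∏ i, Q_x(z_i)) * ∏_{i < j} (z_i - z_j) / (z_i + z_j)`. -/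
def schurQ (x : ℕ → SeriesXY) (lam : StrictPartition) : SeriesXY :=
  ∑' a : Pairs lam.card → ℕ, schurQTerm x (part lam) a

/-- The Schur `P`-function `P_λ(x) = 2 ^ (-ℓ(λ)) * Q_λ(x)`. -/
def schurP (x : ℕ → SeriesXY) (lam : StrictPartition) : SeriesXY :=
  MvPowerSeries.C ((2 : ℚ)⁻¹ ^ lam.card) * schurQ x lam

/-- The unnormalized weight `Q_λ(X) P_λ(Y)`. -/
def weight (lam : StrictPartition) : SeriesXY := schurQ varX lam * schurP varY lam

/-- The normalization constant `Z_SS = ∑_λ Q_λ(X) P_λ(Y)`. -/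
def normConst : SeriesXY := ∑' lam : StrictPartition, weight lam

/-- The (formal) shifted Schur measure of a set of strict partitions. -/
def shiftedSchurMeasure (S : Set StrictPartition) : SeriesXY :=
  ∑' lam : S, normConst⁻¹ * weight lam

/-- The correlation function `ρ_SS(A)`: the measure of the set of all `λ ⊇ A`. -/
def corr (A : Finset ℕ+) : SeriesXY := shiftedSchurMeasure {lam | A ⊆ lam}

/-- A term of the Cauchy product for the coefficient of `z ^ u` in `Q_X(z) * Q_Y(-z⁻¹)`. -/
def JTerm (u : ℤ) (n : ℕ) : SeriesXY :=
  coeffInt (genQ varX) (u + n) * ((-1) ^ n * PowerSeries.coeff n (genQ varY))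

/-- The coefficient of `z ^ u` in the bilateral series `𝕁(z; X, Y) = Q_X(z) * Q_Y(-z⁻¹)`. -/
def JCoeff (u : ℤ) : SeriesXY := ∑' n : ℕ, JTerm u n

/-- A term of the Cauchy product for the coefficient of `z ^ u * w ^ v` in
`𝕁(z) * 𝕁(w) * (z - w) / (z + w)`. -/
def KTerm (u v : ℤ) (n : ℕ) : SeriesXY :=
  MvPowerSeries.C (kernelCoeff n) * (JCoeff (u + n) * JCoeff (v - n))

/-- The sign `ε(u, v)`; only the cases `u, v > 0`, `u > 0 > v` and `u, v < 0` matter. -/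
def eps (u v : ℤ) : ℚ :=
  if 0 < u then (if 0 < v then 1 else (-1) ^ v) else (-1) ^ (u + v)

/-- `𝕂(u, v)`: the sign `ε(u, v)` times the coefficient of `z ^ u * w ^ v` in
`1/2 * 𝕁(z) * 𝕁(w) * (z - w) / (z + w)`. -/
def kernelK (u v : ℤ) : SeriesXY :=
  MvPowerSeries.C (eps u v * (1 / 2)) * ∑' n : ℕ, KTerm u v n

/-- The sequence `k_1, …, k_N, -k_N, …, -k_1`. -/
def signedSeq {N : ℕ} (k : Fin N → ℕ+) (i : Fin (2 * N)) : ℤ :=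
  if h : (i : ℕ) < N then (k ⟨i, h⟩ : ℤ)
  else -(k ⟨2 * N - 1 - i, by omega⟩ : ℤ)

/-- The skew symmetric matrix `M(A)`: its `(i, j)` entry for `i < j` is `𝕂` evaluated at the `i`-th
and `j`-th members of the sequence `k_1, …, k_N, -k_N, …, -k_1`. -/
def matrixM {N : ℕ} (k : Fin N → ℕ+) : Matrix (Fin (2 * N)) (Fin (2 * N)) SeriesXY :=
  fun i j =>
    if i < j then kernelK (signedSeq k i) (signedSeq k j)
    else if j < i then -kernelK (signedSeq k j) (signedSeq k i)
    else 0

/-- The pfaffian of a skew symmetric matrix of size `2 * n`, by expansion along the first row: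
`Pf A = ∑_{j ≥ 2} (-1) ^ j * A_{1 j} * Pf (A without the rows and columns 1 and j)`, with the
pfaffian of the empty matrix equal to `1`. -/
def pfaffian {R : Type*} [CommRing R] : (n : ℕ) → Matrix (Fin (2 * n)) (Fin (2 * n)) R → R
  | 0, _ => 1
  | n + 1, A => ∑ j : Fin (2 * n + 1), (-1) ^ (j : ℕ) * A 0 j.succ *
      pfaffian n (A.submatrix (fun i => (j.succAbove i).succ) (fun i => (j.succAbove i).succ))

theorem coeff_factor_mul (s : ℕ ⊕ ℕ) (P : PowerSeries SeriesXY) (n : ℕ) (d : (ℕ ⊕ ℕ) →₀ ℕ)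
    (hd : d s = 0) :
    MvPowerSeries.coeff d (PowerSeries.coeff n (factor (MvPowerSeries.X s) * P)) =
      MvPowerSeries.coeff d (PowerSeries.coeff n P) := by
  set x : SeriesXY := MvPowerSeries.X s with hx
  set I := PowerSeries.invOfUnit (1 - PowerSeries.C x * PowerSeries.X) 1 with hI
  have h1 : (1 - PowerSeries.C x * PowerSeries.X) * I = 1 :=
    PowerSeries.mul_invOfUnit _ _ (by simp)
  have h2 : factor x * P = P + PowerSeries.C x * (2 * PowerSeries.X * I * P) := by
    have : factor x = (1 + PowerSeries.C x * PowerSeries.X) * I := rfl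
    rw [this]
    linear_combination P * h1
  rw [h2, map_add, PowerSeries.coeff_C_mul, map_add, add_eq_left]
  exact MvPowerSeries.X_dvd_iff.1 (Dvd.intro _ rfl) d hd

theorem coeff_prod_factor_mul (v : ℕ → ℕ ⊕ ℕ) (T : Finset ℕ) (P : PowerSeries SeriesXY) (n : ℕ)
    (d : (ℕ ⊕ ℕ) →₀ ℕ) (hd : ∀ i ∈ T, d (v i) = 0) :
    MvPowerSeries.coeff d
        (PowerSeries.coeff n ((∏ i ∈ T, factor (MvPowerSeries.X (v i))) * P)) =
      MvPowerSeries.coeff d (PowerSeries.coeff n P) := by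
  classical
  induction T using Finset.induction_on with
  | empty => simp
  | insert a T ha ih =>
    rw [Finset.prod_insert ha, mul_assoc, coeff_factor_mul _ _ _ _ (hd a (by simp))]
    exact ih fun i hi => hd i (Finset.mem_insert_of_mem hi)

/-- The infinite product defining `Q_x(z)` converges for distinct variables `x_i`. -/
theorem multipliable_factor (v : ℕ → ℕ ⊕ ℕ) (hv : Function.Injective v) :
    Multipliable fun i => factor (MvPowerSeries.X (v i)) := by
  classical
  let L : ℕ → SeriesXY := fun n d => MvPowerSeries.coeff d (PowerSeries.coeff n
    (∏ i ∈ d.support.preimage v hv.injOn, factor (MvPowerSeries.X (v i))))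
  refine ⟨PowerSeries.mk L, ?_⟩
  rw [HasProd, PowerSeries.WithPiTopology.tendsto_iff_coeff_tendsto]
  intro n
  rw [MvPowerSeries.WithPiTopology.tendsto_iff_coeff_tendsto, PowerSeries.coeff_mk]
  intro d
  refine tendsto_const_nhds.congr' ?_
  simp only [SummationFilter.unconditional_filter]
  filter_upwards [Filter.eventually_ge_atTop (d.support.preimage v hv.injOn)] with s hs
  rw [← Finset.prod_sdiff hs, coeff_prod_factor_mul]
  · rfl
  · intro i hi
    simpa using (Finset.mem_sdiff.1 hi).2

theorem multipliable_factor_varX : Multipliable fun i => factor (varX i) :=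
  multipliable_factor Sum.inl Sum.inl_injective

theorem multipliable_factor_varY : Multipliable fun i => factor (varY i) :=
  multipliable_factor Sum.inr Sum.inr_injective

end

end ShiftedSchur

/-!
The proof uses neutral fermions `φ_n`, `n ∈ ℤ`, with `φ_a φ_b + φ_b φ_a = 2 (-1) ^ a δ_{a + b, 0}`,
realized as vertex operators.

Let `QRing` be the universal ring generated by the coefficients of a series `Q(z)` with
`Q(z) Q(-z) = 1`. The vertex operator `B(z)` on `QRing` substitutes `Q(w) (z - w) / (z + w)` for
`Q(w)` and then multiplies by `Q(z)`. Unfolding the definition shows that the coefficient defining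
`Q_λ` is `B_{λ_1} B_{λ_2} ⋯ 1` (`bprod_ofFn`), while the modes `B_a` are neutral fermions
(`vop_anticomm`), and the modes of `Q(-z) B(z)` at positive powers of `z` vanish, its constant term
being the identity (`sum_qq_vop`). Everything in this part is polynomial, so nothing has to converge.

Specializing `Q(z)` to `Q_X(z)` and to `Q_Y(z)` gives two functionals `⟨X|` and `⟨Y|` on words in
fermions. They are paired by `⟨w, w'⟩ = ∑_λ 2 ^ (-ℓ(λ)) ⟨X| φ_w |λ⟩ ⟨Y| φ_{w'} |λ⟩` (`pairing`), so
that the normalization constant is `⟨∅, ∅⟩`. Adding or removing the part `m` of `λ` shows that `φ_m`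
can be carried from the end of `w` to `w'`, where it becomes `(-1) ^ m φ_{-m}` (`pairing_adjoint`).
Let `g(z) = ∑ ⟨φ_m φ_w, ∅⟩ z ^ m` for a word `w` of odd length. The annihilation property for `⟨X|`
determines the nonnegative modes of `Q_X(-z) g(z)`. The one for `⟨Y|`, after `φ(z)` has been moved
through `w`, determines the nonpositive modes of `Q_Y(1 / z) g(z)` in terms of the contractions of
`φ(z)` with the letters of `w`. Together they determine
`Q_X(-z) Q_Y(1 / z) g(z) = J(z)⁻¹ g(z)`, hence `g(z)`; the outcome is Wick's theorem
(`pairing_wick`), whose two-point function is the coefficient of `z ^ u w ^ v` in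
`J(z) J(w) (z - w) / (z + w)`. Iterating it gives a pfaffian (`pairing_ofFn`).

Finally `2⁻¹ (-1) ^ k φ_k φ_{-k}` is the projection onto the strict partitions that contain `k`, so
that `⟨φ_{k_1} ⋯ φ_{k_N} φ_{-k_N} ⋯ φ_{-k_1}, ∅⟩` is, up to an explicit factor, the sum of the
weights of all `λ ⊇ A` (`pairing_nested`).

Convergence is controlled by total degree: the specialization of `B_{l_1} B_{l_2} ⋯ 1` is
homogeneous of degree `∑ l_i`, and in particular zero if this is negative.
-/

namespace ShiftedSchur

noncomputable section

/-! ### Signs and the coefficients of `(1 - t) / (1 + t)` -/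

/-- The sign `(-1) ^ n` of an integer `n`. -/
def sg (n : ℤ) : ℤ := n.negOnePow

@[simp] lemma sg_zero : sg 0 = 1 := by simp [sg]

lemma sg_add (m n : ℤ) : sg (m + n) = sg m * sg n := by simp [sg, Int.negOnePow_add]

@[simp] lemma sg_neg (n : ℤ) : sg (-n) = sg n := by simp [sg]

lemma sg_sub (m n : ℤ) : sg (m - n) = sg m * sg n := by rw [sub_eq_add_neg, sg_add, sg_neg]

@[simp] lemma sg_natCast (n : ℕ) : sg (n : ℤ) = (-1) ^ n := Int.coe_negOnePow_natCast n

@[simp] lemma sg_mul_self (n : ℤ) : sg n * sg n = 1 := by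
  rw [← sg_sub, sub_self, sg_zero]

/-- The coefficient of `t ^ n` in `(1 - t) / (1 + t)`, as an integer. -/
def kap (n : ℕ) : ℤ := if n = 0 then 1 else 2 * (-1) ^ n

@[simp] lemma kap_zero : kap 0 = 1 := by simp [kap]

/-- The power series `(1 - t) / (1 + t)` with integer coefficients. -/
def kapSeries : PowerSeries ℤ := PowerSeries.mk kap

lemma kap_succ_add (n : ℕ) : kap (n + 1) + kap n = if n = 0 then -1 else 0 := by
  rcases n with _ | n
  · simp [kap]
  · simp [kap, pow_succ]

lemma one_add_X_mul_kapSeries : (1 + PowerSeries.X) * kapSeries = 1 - PowerSeries.X := by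
  ext n
  rcases n with _ | n
  · simp [add_mul, kapSeries]
  · rw [add_mul, one_mul, map_add, PowerSeries.coeff_succ_X_mul]
    simp only [kapSeries, PowerSeries.coeff_mk, kap_succ_add, map_sub, PowerSeries.coeff_one,
      PowerSeries.coeff_X]
    rcases n with _ | n <;> simp

lemma kapSeries_mul_evalNeg : kapSeries * PowerSeries.evalNegHom kapSeries = 1 := by
  have h := one_add_X_mul_kapSeries
  have h' := congrArg PowerSeries.evalNegHom h
  simp only [map_mul, map_add, map_sub, map_one, PowerSeries.evalNegHom_X] at h'
  have hX : (1 + PowerSeries.X : PowerSeries ℤ) ≠ 0 := fun h0 => by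
    have := congrArg (PowerSeries.coeff 0) h0
    simp at this
  have hX' : (1 - PowerSeries.X : PowerSeries ℤ) ≠ 0 := fun h0 => by
    have := congrArg (PowerSeries.coeff 0) h0
    simp at this
  apply mul_left_cancel₀ (mul_ne_zero hX hX')
  linear_combination (1 - PowerSeries.X) * PowerSeries.evalNegHom kapSeries * h +
    (1 - PowerSeries.X) * h'

lemma kernelCoeff_eq (n : ℕ) : kernelCoeff n = (kap n : ℚ) := by
  have h := congrArg (PowerSeries.map (Int.castRingHom ℚ)) one_add_X_mul_kapSeries
  simp only [map_mul, map_add, map_sub, map_one, PowerSeries.map_X] at h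
  have h1 : (1 + PowerSeries.X : PowerSeries ℚ) * (1 + PowerSeries.X : PowerSeries ℚ)⁻¹ = 1 :=
    PowerSeries.mul_inv_cancel _ (by simp)
  have : (1 - PowerSeries.X) * (1 + PowerSeries.X : PowerSeries ℚ)⁻¹
      = PowerSeries.map (Int.castRingHom ℚ) kapSeries := by
    linear_combination (PowerSeries.map (Int.castRingHom ℚ) kapSeries) * h1 -
      (1 + PowerSeries.X : PowerSeries ℚ)⁻¹ * h
  rw [kernelCoeff, this]
  simp [kapSeries]

lemma sum_neg_one_pow_mul_kap (n : ℕ) :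
    ∑ p ∈ Finset.HasAntidiagonal.antidiagonal n, kap p.1 * ((-1) ^ p.2 * kap p.2) = if n = 0 then 1 else 0 := by
  have := congrArg (PowerSeries.coeff n) kapSeries_mul_evalNeg
  simpa [PowerSeries.coeff_mul, PowerSeries.evalNegHom, PowerSeries.coeff_rescale, kapSeries,
    PowerSeries.coeff_one] using this

/-! ### The ring generated by the `q_n` -/

/-- The series `1 + ∑ q_n z ^ n` with free coefficients; the variable of index `m` is
`q_{m + 1}`. -/
def freeQ : PowerSeries (MvPolynomial ℕ ℤ) :=
  PowerSeries.mk fun n => n.casesOn 1 fun m => MvPolynomial.X m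

/-- The ideal generated by the coefficients of `Q(z) * Q(-z) - 1`. -/
def relIdeal : Ideal (MvPolynomial ℕ ℤ) :=
  Ideal.span (Set.range fun n => PowerSeries.coeff n (freeQ * PowerSeries.evalNegHom freeQ - 1))

/-- The universal ring generated by `q_1, q_2, …` subject to `Q(z) * Q(-z) = 1`, where
`Q(z) = 1 + ∑ q_n z ^ n`. -/
def QRing : Type := MvPolynomial ℕ ℤ ⧸ relIdeal

instance : CommRing QRing := inferInstanceAs (CommRing (MvPolynomial ℕ ℤ ⧸ relIdeal))

/-- The projection from the free ring to `QRing`. -/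
def qMk : MvPolynomial ℕ ℤ →+* QRing := Ideal.Quotient.mk relIdeal

/-- The universal series `Q(z)`. -/
def univQ : PowerSeries QRing := PowerSeries.map qMk freeQ

/-- The generator `q_n` for an integer `n`; it is `0` for negative `n` and `1` for `n = 0`. -/
def qq (n : ℤ) : QRing := if 0 ≤ n then PowerSeries.coeff n.toNat univQ else 0

lemma map_evalNegHom {A B : Type*} [CommRing A] [CommRing B] (f : A →+* B) (P : PowerSeries A) :
    PowerSeries.map f (PowerSeries.evalNegHom P) = PowerSeries.evalNegHom (PowerSeries.map f P) := by
  ext n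
  simp [PowerSeries.evalNegHom, PowerSeries.coeff_rescale]

lemma univQ_mul_evalNeg : univQ * PowerSeries.evalNegHom univQ = 1 := by
  have : PowerSeries.map qMk
      (freeQ * PowerSeries.evalNegHom freeQ - 1) = 0 := by
    ext n
    rw [PowerSeries.coeff_map, map_zero]
    exact Ideal.Quotient.eq_zero_iff_mem.2 (Ideal.subset_span ⟨n, rfl⟩)
  rw [map_sub, map_mul, map_evalNegHom, map_one, sub_eq_zero] at this
  exact this

lemma coeff_univQ_zero : PowerSeries.coeff 0 univQ = 1 := by
  simp [univQ, freeQ]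

@[simp] lemma qq_zero : qq 0 = 1 := by simp [qq, coeff_univQ_zero]

lemma qq_of_neg {n : ℤ} (h : n < 0) : qq n = 0 := by simp [qq, not_le.2 h]

lemma qq_natCast (n : ℕ) : qq n = PowerSeries.coeff n univQ := by simp [qq]

section lift
variable {S : Type*} [CommRing S] (P : PowerSeries S)

/-- The ring homomorphism from the free ring sending the formal generator `q_n` to the
`n`-th coefficient of `P`. -/
def freeLift : MvPolynomial ℕ ℤ →+* S :=
  MvPolynomial.eval₂Hom (Int.castRingHom S) fun n => PowerSeries.coeff (n + 1) P

lemma map_freeLift (h0 : PowerSeries.coeff 0 P = 1) : PowerSeries.map (freeLift P) freeQ = P := by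
  ext n
  rcases n with _ | n
  · simp [freeQ, h0]
  · simp [freeQ, freeLift]

/-- The ring homomorphism from `QRing` which sends the universal series `Q(z)` to `P`. -/
def qLift (h0 : PowerSeries.coeff 0 P = 1) (h : P * PowerSeries.evalNegHom P = 1) : QRing →+* S :=
  Ideal.Quotient.lift relIdeal (freeLift P) (by
    intro a ha
    rw [← RingHom.mem_ker]
    refine Ideal.span_le.2 ?_ ha
    rintro _ ⟨n, rfl⟩
    simp only [SetLike.mem_coe, RingHom.mem_ker]
    rw [← PowerSeries.coeff_map, map_sub, map_mul, map_evalNegHom, map_freeLift P h0, h]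
    simp)

lemma qLift_qMk (h0 : PowerSeries.coeff 0 P = 1) (h : P * PowerSeries.evalNegHom P = 1)
    (a : MvPolynomial ℕ ℤ) : qLift P h0 h (qMk a) = freeLift P a := rfl

lemma map_qLift (h0 : PowerSeries.coeff 0 P = 1) (h : P * PowerSeries.evalNegHom P = 1) :
    PowerSeries.map (qLift P h0 h) univQ = P := by
  rw [univQ]
  ext n
  conv_rhs => rw [← map_freeLift P h0]
  simp [qLift_qMk]

lemma qLift_qq (h0 : PowerSeries.coeff 0 P = 1) (h : P * PowerSeries.evalNegHom P = 1) (n : ℤ) :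
    qLift P h0 h (qq n) = if 0 ≤ n then PowerSeries.coeff n.toNat P else 0 := by
  unfold qq
  split_ifs
  · rw [← PowerSeries.coeff_map, map_qLift]
  · simp

end lift

lemma QRing.hom_ext {S : Type*} [CommRing S] {f g : QRing →+* S}
    (h : ∀ n : ℕ, f (qq n) = g (qq n)) : f = g := by
  suffices f.comp qMk = g.comp qMk by
    apply RingHom.ext
    intro x
    obtain ⟨a, rfl⟩ : ∃ a, qMk a = x := Ideal.Quotient.mk_surjective x
    exact DFunLike.congr_fun this a
  apply MvPolynomial.ringHom_ext
  · intro n; simp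
  · intro n
    have h' := h (n + 1)
    rw [qq_natCast] at h'
    simpa [univQ, freeQ] using h'

/-! ### The translation `Q(w) ↦ Q(w) * (1 - t w) / (1 + t w)` -/

/-- The series `Q(w) * (1 - t w) / (1 + t w)` with coefficients in `QRing[t]`. -/
def shiftedQ : PowerSeries (Polynomial QRing) :=
  PowerSeries.map Polynomial.C univQ *
    PowerSeries.rescale Polynomial.X (PowerSeries.map (Int.castRingHom _) kapSeries)

lemma coeff_shiftedQ_zero : PowerSeries.coeff 0 shiftedQ = 1 := by
  rw [shiftedQ, PowerSeries.coeff_mul]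
  simp [-PowerSeries.coeff_zero_eq_constantCoeff, PowerSeries.coeff_rescale, coeff_univQ_zero,
    kapSeries]

lemma evalNegHom_rescale {A : Type*} [CommRing A] (a : A) (P : PowerSeries A) :
    PowerSeries.evalNegHom (PowerSeries.rescale a P) =
      PowerSeries.rescale a (PowerSeries.evalNegHom P) := by
  ext n
  simp only [PowerSeries.evalNegHom, PowerSeries.coeff_rescale]
  ring

lemma shiftedQ_mul_evalNeg : shiftedQ * PowerSeries.evalNegHom shiftedQ = 1 := by
  have h1 := congrArg (PowerSeries.map (Polynomial.C (R := QRing))) univQ_mul_evalNeg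
  have h2 := congrArg (fun P => PowerSeries.rescale (Polynomial.X (R := QRing))
    (PowerSeries.map (Int.castRingHom _) P)) kapSeries_mul_evalNeg
  simp only [map_mul, map_evalNegHom, map_one, ← evalNegHom_rescale] at h1 h2
  rw [shiftedQ, map_mul, mul_mul_mul_comm, h1, h2, one_mul]

/-- The ring homomorphism `Q(w) ↦ Q(w) * (1 - t w) / (1 + t w)`. -/
def tau : QRing →+* Polynomial QRing := qLift shiftedQ coeff_shiftedQ_zero shiftedQ_mul_evalNeg

/-- The coefficient of `t ^ k` in `tau γ`. -/
def tauC (k : ℕ) (γ : QRing) : QRing := (tau γ).coeff k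

lemma tauC_add (k : ℕ) (γ δ : QRing) : tauC k (γ + δ) = tauC k γ + tauC k δ := by
  simp [tauC]

lemma tau_qq (n : ℤ) (k : ℕ) : tauC k (qq n) = kap k * qq (n - k) := by
  unfold tauC tau
  rw [qLift_qq]
  split_ifs with h
  · lift n to ℕ using h
    rw [Int.toNat_natCast, shiftedQ, PowerSeries.coeff_mul, Polynomial.finsetSum_coeff]
    have : ∀ p ∈ Finset.HasAntidiagonal.antidiagonal n,
        (PowerSeries.coeff p.1 (PowerSeries.map Polynomial.C univQ) *
          PowerSeries.coeff p.2 (PowerSeries.rescale (Polynomial.X (R := QRing))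
            (PowerSeries.map (Int.castRingHom _) kapSeries))).coeff k =
        if p.2 = k then kap k * PowerSeries.coeff p.1 univQ else 0 := by
      intro p _
      rw [PowerSeries.coeff_map, PowerSeries.coeff_rescale, PowerSeries.coeff_map,
        Polynomial.coeff_C_mul]
      simp only [kapSeries, PowerSeries.coeff_mk, eq_intCast]
      rw [← map_intCast (Polynomial.C (R := QRing)), Polynomial.coeff_mul_C,
        Polynomial.coeff_X_pow]
      split_ifs with h1 h2 h2
      · subst h1; ring
      · exact absurd h1.symm h2
      · exact absurd h2.symm h1
      · ring
    -- Only the term of degree `k` in `t` of the second factor contributes.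
    rw [Finset.sum_congr rfl this, Finset.sum_ite, Finset.sum_const_zero, add_zero]
    by_cases hk : k ≤ n
    · rw [Finset.sum_eq_single (n - k, k)]
      · rw [← Nat.cast_sub hk, qq_natCast]
      · rintro ⟨a, b⟩ hab hne
        simp only [Finset.mem_filter, Finset.HasAntidiagonal.mem_antidiagonal] at hab
        exact absurd (Prod.ext (by simp; omega) hab.2) hne
      · intro hn
        exact absurd (by simp [hk]) hn
    · rw [qq_of_neg (by omega), mul_zero]
      apply Finset.sum_eq_zero
      rintro ⟨a, b⟩ hab
      simp only [Finset.mem_filter, Finset.HasAntidiagonal.mem_antidiagonal] at hab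
      omega
  · rw [qq_of_neg (by omega)]
    simp

lemma tauC_mul (k : ℕ) (γ δ : QRing) :
    tauC k (γ * δ) = ∑ p ∈ Finset.HasAntidiagonal.antidiagonal k, tauC p.1 γ * tauC p.2 δ := by
  simp [tauC, Polynomial.coeff_mul]

/-- Translation by `t = 0` is the identity. -/
lemma tauC_zero (γ : QRing) : tauC 0 γ = γ := by
  have : (Polynomial.constantCoeff).comp tau = RingHom.id QRing := by
    apply QRing.hom_ext
    intro n
    have := tau_qq n 0
    simpa [tauC] using this
  exact DFunLike.congr_fun this γ

lemma coeff_coeff_swap {A : Type*} [CommRing A] (p : Polynomial (Polynomial A)) (i j : ℕ) :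
    ((Polynomial.Bivariate.swap p).coeff i).coeff j = (p.coeff j).coeff i := by
  induction p using Polynomial.induction_on' with
  | add p q hp hq => simp [hp, hq]
  | monomial n f =>
    induction f using Polynomial.induction_on' with
    | add p q hp hq => simp only [map_add, Polynomial.coeff_add, hp, hq]
    | monomial m r =>
      rw [Polynomial.Bivariate.swap_monomial_monomial]
      simp only [Polynomial.coeff_monomial]
      split_ifs <;> simp_all [Polynomial.coeff_monomial]

lemma tauC_tauC_qq (j k : ℕ) (n : ℤ) :
    tauC j (tauC k (qq n)) = kap k * (kap j * qq (n - k - j)) := by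
  rw [tau_qq, tauC_mul, Finset.sum_eq_single (0, j)]
  · rw [tau_qq, tauC, map_intCast, ← map_intCast (Polynomial.C (R := QRing)),
      Polynomial.coeff_C_zero]
  · rintro ⟨a, b⟩ hab hne
    simp only [Finset.HasAntidiagonal.mem_antidiagonal] at hab
    have : a ≠ 0 := by rintro rfl; simp at hab; simp [hab] at hne
    rw [tauC, map_intCast, ← map_intCast (Polynomial.C (R := QRing)),
      Polynomial.coeff_C_of_ne_zero this, zero_mul]
  · simp

/-- Two translations commute. -/
lemma tauC_comm (j k : ℕ) (γ : QRing) : tauC j (tauC k γ) = tauC k (tauC j γ) := by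
  have h : (Polynomial.mapRingHom tau).comp tau =
      (Polynomial.Bivariate.swap (R := QRing) : _ →+* _).comp
        ((Polynomial.mapRingHom tau).comp tau) := by
    apply QRing.hom_ext
    intro n
    ext k j
    have e : ∀ j k, (((tau (qq n)).map tau).coeff k).coeff j = tauC j (tauC k (qq n)) := by
      intro j k; simp [tauC]
    simp only [RingHom.coe_comp, Function.comp_apply, Polynomial.coe_mapRingHom, RingHom.coe_coe,
      coeff_coeff_swap, e, tauC_tauC_qq]
    rw [sub_right_comm]; ring
  have := congrArg (fun f => (f.coeff k).coeff j) (DFunLike.congr_fun h γ)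
  simpa only [tauC, RingHom.coe_comp, Function.comp_apply, Polynomial.coe_mapRingHom,
      RingHom.coe_coe, coeff_coeff_swap, Polynomial.coeff_map] using this

/-- Substituting `-t` for the variable of a polynomial after translating its coefficients. -/
lemma coeff_eval₂_tau (n : ℕ) (p : Polynomial QRing) :
    (Polynomial.eval₂ tau (-Polynomial.X) p).coeff n =
      ∑ x ∈ Finset.HasAntidiagonal.antidiagonal n, (-1) ^ x.2 * tauC x.1 (p.coeff x.2) := by
  induction p using Polynomial.induction_on' with
  | add p q hp hq => simp [hp, hq, mul_add, Finset.sum_add_distrib, tauC_add]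
  | monomial m r =>
    rw [Polynomial.eval₂_monomial, neg_pow, ← mul_assoc, Polynomial.coeff_mul_X_pow',
      ← map_one Polynomial.C, ← map_neg, ← map_pow, Polynomial.coeff_mul_C]
    have h0 : ∀ k, tauC k 0 = 0 := by simp [tauC]
    split_ifs with h
    · rw [Finset.sum_eq_single (n - m, m)]
      · simp [tauC, mul_comm]
      · rintro ⟨a, b⟩ hab hne
        simp only [Finset.HasAntidiagonal.mem_antidiagonal] at hab
        have : m ≠ b := by rintro rfl; exact hne (Prod.ext (by simp; omega) rfl)
        simp [Polynomial.coeff_monomial, this, h0]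
      · intro hn
        exact absurd (by simp [h]) hn
    · rw [Finset.sum_eq_zero]
      rintro ⟨a, b⟩ hab
      simp only [Finset.HasAntidiagonal.mem_antidiagonal] at hab
      have : m ≠ b := by rintro rfl; omega
      simp [Polynomial.coeff_monomial, this, h0]

/-- The translations by `t` and `-t` are inverse to each other. -/
lemma sum_tauC_tauC (n : ℕ) (γ : QRing) :
    ∑ p ∈ Finset.HasAntidiagonal.antidiagonal n, (-1) ^ p.2 * tauC p.1 (tauC p.2 γ) =
      if n = 0 then γ else 0 := by
  have h : (Polynomial.eval₂RingHom tau (-Polynomial.X)).comp tau = Polynomial.C := by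
    apply QRing.hom_ext
    intro m
    ext k
    simp only [RingHom.coe_comp, Function.comp_apply, Polynomial.coe_eval₂RingHom,
      coeff_eval₂_tau]
    have key : ∀ j k, tauC j ((tau (qq m)).coeff k) = kap k * (kap j * qq (m - k - j)) := by
      intro j k
      change tauC j (tauC k (qq m)) = _
      rw [tauC_tauC_qq]
    simp only [key]
    have : ∀ x ∈ Finset.HasAntidiagonal.antidiagonal k,
        (-1 : QRing) ^ x.2 * (kap x.2 * (kap x.1 * qq (m - x.2 - x.1))) =
        ((kap x.1 * ((-1) ^ x.2 * kap x.2) : ℤ) : QRing) * qq (m - k) := by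
      intro x hx
      rw [Finset.HasAntidiagonal.mem_antidiagonal] at hx
      rw [← hx]
      push_cast
      rw [sub_sub, add_comm (x.2 : ℤ)]
      ring
    rw [Finset.sum_congr rfl this, ← Finset.sum_mul, ← Int.cast_sum, sum_neg_one_pow_mul_kap,
      Polynomial.coeff_C]
    split_ifs with h <;> simp [h]
  have := congrArg (fun f => f.coeff n) (DFunLike.congr_fun h γ)
  simp only [RingHom.coe_comp, Function.comp_apply, Polynomial.coe_eval₂RingHom,
    coeff_eval₂_tau, Polynomial.coeff_C] at this
  exact this

/-! ### Vertex operators -/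

/-- The coefficient of `z ^ a` in `Q(z) * p(1 / z)`, for a polynomial `p`. -/
def extr (a : ℤ) (p : Polynomial QRing) : QRing := p.sum fun k c => qq (a + k) * c

lemma extr_add (a : ℤ) (p r : Polynomial QRing) : extr a (p + r) = extr a p + extr a r :=
  Polynomial.sum_add_index _ _ _ (by simp) (by simp [mul_add])

lemma extr_zero (a : ℤ) : extr a 0 = 0 := Polynomial.sum_zero_index _

lemma extr_sum {ι : Type*} (a : ℤ) (s : Finset ι) (p : ι → Polynomial QRing) :
    extr a (∑ i ∈ s, p i) = ∑ i ∈ s, extr a (p i) :=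
  map_sum (⟨⟨extr a, extr_zero a⟩, extr_add a⟩ : Polynomial QRing →+ QRing) p s

lemma extr_eq_sum_range (a : ℤ) (p : Polynomial QRing) (N : ℕ) (h : ∀ k, N ≤ k → p.coeff k = 0) :
    extr a p = ∑ k ∈ Finset.range N, qq (a + k) * p.coeff k := by
  refine Polynomial.sum_eq_of_subset _ (by simp) fun k hk => ?_
  rw [Finset.mem_range]
  by_contra hn
  exact Polynomial.mem_support_iff.1 hk (h k (not_lt.1 hn))

lemma extr_monomial (a : ℤ) (k : ℕ) (c : QRing) :
    extr a (Polynomial.monomial k c) = qq (a + k) * c :=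
  Polynomial.sum_monomial_index _ _ (by simp)

lemma extr_monomial_mul (a : ℤ) (i : ℕ) (c : QRing) (p : Polynomial QRing) :
    extr a (Polynomial.monomial i c * p) = c * extr (a + i) p := by
  induction p using Polynomial.induction_on' with
  | add p q hp hq => rw [mul_add, extr_add, hp, hq, extr_add, mul_add]
  | monomial n r =>
    rw [Polynomial.monomial_mul_monomial, extr_monomial, extr_monomial]
    push_cast
    rw [add_assoc]; ring

/-- The coefficient `B_a` of `z ^ a` in the vertex operator `B(z)`, which multiplies by `Q(z)`
after the substitution `Q(w) ↦ Q(w) * (z - w) / (z + w)`. -/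
def vop (a : ℤ) (γ : QRing) : QRing := extr a (tau γ)

lemma vop_add (a : ℤ) (γ δ : QRing) : vop a (γ + δ) = vop a γ + vop a δ := by
  rw [vop, map_add, extr_add]; rfl

/-- `B_a` as an additive map. -/
def vopHom (a : ℤ) : QRing →+ QRing := ⟨⟨vop a, by simp [vop, extr_zero]⟩, vop_add a⟩

@[simp] lemma vopHom_apply (a : ℤ) (γ : QRing) : vopHom a γ = vop a γ := rfl

lemma vop_one (a : ℤ) : vop a 1 = qq a := by
  rw [vop, map_one, ← Polynomial.C_1, ← Polynomial.monomial_zero_left, extr_monomial]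
  simp

lemma tau_qq_eq (n : ℤ) (N : ℕ) (h : n < N) :
    tau (qq n) = ∑ i ∈ Finset.range N, Polynomial.monomial i (kap i * qq (n - i)) := by
  ext k
  rw [Polynomial.finsetSum_coeff]
  simp only [Polynomial.coeff_monomial, Finset.sum_ite_eq', Finset.mem_range]
  change tauC k (qq n) = _
  rw [tau_qq]
  split_ifs with hk
  · rfl
  · rw [qq_of_neg (by omega), mul_zero]

lemma vop_qq_mul (a n : ℤ) (N : ℕ) (h : n < N) (γ : QRing) :
    vop a (qq n * γ) = ∑ i ∈ Finset.range N, kap i * qq (n - i) * vop (a + i) γ := by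
  rw [vop, map_mul, tau_qq_eq n N h, Finset.sum_mul, extr_sum]
  exact Finset.sum_congr rfl fun i _ => extr_monomial_mul _ _ _ _

lemma exists_bound_tauC (γ : QRing) : ∃ D : ℕ, ∀ k, D ≤ k → tauC k γ = 0 :=
  ⟨(tau γ).natDegree + 1, fun _ hk => Polynomial.coeff_eq_zero_of_natDegree_lt hk⟩

lemma vop_eq_sum_range (a : ℤ) (γ : QRing) (D : ℕ) (h : ∀ k, D ≤ k → tauC k γ = 0) :
    vop a γ = ∑ k ∈ Finset.range D, qq (a + k) * tauC k γ :=
  extr_eq_sum_range a _ D h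

/-- The formal identity `(z - w) / (z + w) + (w - z) / (w + z) = 2 ∑_{i ∈ ℤ} (-1) ^ i z ^ i w ^ (-i)`
for the two opposite expansions. -/
lemma sum_kap_mul_symm {A : Type*} [CommRing A] (u : ℤ → A) (N : ℕ) :
    ∑ i ∈ Finset.range (N + 1), (kap i : A) * (u i + u (-i)) =
      2 * ∑ i ∈ Finset.Icc (-N : ℤ) N, (sg i : A) * u i := by
  induction N with
  | zero => simp; ring
  | succ N ih =>
    have e : Finset.Icc (-(N + 1 : ℕ) : ℤ) (N + 1 : ℕ) =
        insert (-(N + 1 : ℕ) : ℤ) (insert ((N + 1 : ℕ) : ℤ) (Finset.Icc (-N : ℤ) N)) := by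
      ext x; simp only [Finset.mem_Icc, Finset.mem_insert]; omega
    rw [Finset.sum_range_succ, ih, e, Finset.sum_insert, Finset.sum_insert, sg_neg, sg_natCast]
    · simp only [kap]; push_cast; simp; ring
    · simp
    · simp only [Finset.mem_Icc, Finset.mem_insert]; omega

lemma sum_antidiagonal_qq (n : ℕ) :
    ∑ x ∈ Finset.HasAntidiagonal.antidiagonal n, (-1) ^ x.1 * (qq x.1 * qq x.2) =
      if n = 0 then 1 else 0 := by
  have := congrArg (PowerSeries.coeff n) univQ_mul_evalNeg
  rw [mul_comm, PowerSeries.coeff_mul, PowerSeries.coeff_one] at this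
  rw [← this]
  refine Finset.sum_congr rfl fun x _ => ?_
  rw [PowerSeries.evalNegHom, PowerSeries.coeff_rescale, qq_natCast, qq_natCast, mul_assoc]

/-- The formal delta function restricts to `w = -z`, where `Q(z) * Q(w) = 1`. -/
lemma sum_sg_qq (a b : ℤ) (N : ℕ) (ha : a ≤ N) (hb : b ≤ N) :
    ∑ i ∈ Finset.Icc (-N : ℤ) N, (sg i : QRing) * (qq (a + i) * qq (b - i)) =
      if a + b = 0 then (sg a : QRing) else 0 := by
  rcases lt_or_ge (a + b) 0 with h | h
  · rw [if_neg h.ne]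
    apply Finset.sum_eq_zero
    intro i _
    rcases lt_or_ge (a + i) 0 with h1 | h1
    · rw [qq_of_neg h1]; ring
    · rw [qq_of_neg (n := b - i) (by omega)]; ring
  · obtain ⟨n, hn⟩ := Int.eq_ofNat_of_zero_le h
    have h1 := sum_antidiagonal_qq n
    have h2 : ∑ x ∈ Finset.HasAntidiagonal.antidiagonal n,
        (sg a : QRing) * ((-1) ^ x.1 * (qq x.1 * qq x.2)) =
        ∑ i ∈ Finset.Icc (-N : ℤ) N, (sg i : QRing) * (qq (a + i) * qq (b - i)) := by
      apply Finset.sum_of_injOn (fun x => (x.1 : ℤ) - a)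
      · rintro ⟨x, y⟩ hx ⟨x', y'⟩ hx' hxx
        simp only [Finset.mem_coe, Finset.HasAntidiagonal.mem_antidiagonal] at hx hx' hxx
        ext <;> simp <;> omega
      · rintro ⟨x, y⟩ hx
        simp only [Finset.mem_coe, Finset.HasAntidiagonal.mem_antidiagonal, Finset.mem_Icc] at hx ⊢
        omega
      · intro i hi hni
        rcases lt_or_ge (a + i) 0 with h1 | h1
        · rw [qq_of_neg h1]; ring
        rcases lt_or_ge (b - i) 0 with h2 | h2
        · rw [qq_of_neg h2]; ring
        refine absurd ⟨((a + i).toNat, (b - i).toNat), ?_, ?_⟩ hni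
        · simp only [Finset.mem_coe, Finset.HasAntidiagonal.mem_antidiagonal]; omega
        · simp only; omega
      · rintro ⟨x, y⟩ hx
        simp only [Finset.HasAntidiagonal.mem_antidiagonal] at hx ⊢
        rw [sg_sub, sg_natCast, show a + ((x : ℤ) - a) = x by ring,
          show b - ((x : ℤ) - a) = y by omega]
        push_cast; ring
    rw [← h2, ← Finset.mul_sum, h1, hn]
    simp

/-- The anticommutation relation of the neutral fermions `B_a`. -/
lemma vop_anticomm (a b : ℤ) (γ : QRing) :
    vop a (vop b γ) + vop b (vop a γ) = if a + b = 0 then 2 * (sg a : QRing) * γ else 0 := by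
  obtain ⟨D, hD⟩ := exists_bound_tauC γ
  have hD2 : ∀ m k, D ≤ k → tauC k (tauC m γ) = 0 := by
    intro m k hk
    rw [tauC_comm, hD k hk]; simp [tauC]
  -- All `q_n` with `n < 0` vanish, so sums over `i ≤ N` capture all terms.
  obtain ⟨N, hN⟩ : ∃ N : ℕ, |a| + |b| + D ≤ N := ⟨(|a| + |b| + D).toNat, Int.self_le_toNat _⟩
  have hab := abs_le.1 (le_refl |a|)
  have hbb := abs_le.1 (le_refl |b|)
  have key : ∀ a b : ℤ, b + D ≤ N → vop a (vop b γ) =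
      ∑ i ∈ Finset.range (N + 1), ∑ m ∈ Finset.range D, ∑ j ∈ Finset.range D,
        (kap i : QRing) * (qq (a + i + j) * qq (b - i + m) * tauC j (tauC m γ)) := by
    intro a b hb
    rw [vop_eq_sum_range b γ D hD, ← vopHom_apply, map_sum, Finset.sum_comm]
    refine Finset.sum_congr rfl fun m hm => ?_
    rw [Finset.mem_range] at hm
    rw [vopHom_apply, vop_qq_mul a (b + m) (N + 1) (by push_cast; omega)]
    refine Finset.sum_congr rfl fun i _ => ?_
    rw [vop_eq_sum_range _ _ D (hD2 m), Finset.mul_sum]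
    refine Finset.sum_congr rfl fun j _ => ?_
    rw [show b + (m : ℤ) - i = b - i + m by ring]
    ring
  rw [key a b (by omega), key b a (by omega)]
  -- Since translations commute, the coefficients apart from `kap i` are symmetric in the two modes.
  have h1 : ∑ i ∈ Finset.range (N + 1), ∑ m ∈ Finset.range D, ∑ j ∈ Finset.range D,
        (kap i : QRing) * (qq (b + i + j) * qq (a - i + m) * tauC j (tauC m γ)) =
      ∑ i ∈ Finset.range (N + 1), ∑ m ∈ Finset.range D, ∑ j ∈ Finset.range D,
        (kap i : QRing) * (qq (a - i + j) * qq (b + i + m) * tauC j (tauC m γ)) := by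
    refine Finset.sum_congr rfl fun i _ => ?_
    rw [Finset.sum_comm]
    refine Finset.sum_congr rfl fun m _ => Finset.sum_congr rfl fun j _ => ?_
    rw [tauC_comm]; ring
  rw [h1, ← Finset.sum_add_distrib]
  simp only [← Finset.sum_add_distrib, ← mul_add, ← add_mul]
  rw [Finset.sum_comm]
  -- Summing over `i` leaves only the terms with `a + b + j + m = 0`.
  have h2 : ∀ m ∈ Finset.range D, ∑ i ∈ Finset.range (N + 1), ∑ j ∈ Finset.range D,
      (kap i : QRing) * ((qq (a + i + j) * qq (b - i + m) + qq (a - i + j) * qq (b + i + m)) *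
        tauC j (tauC m γ)) = ∑ j ∈ Finset.range D,
        2 * (sg a : QRing) * (if (j + m : ℤ) = -(a + b) then (-1) ^ j * tauC j (tauC m γ) else 0) := by
    intro m hm
    rw [Finset.mem_range] at hm
    rw [Finset.sum_comm]
    refine Finset.sum_congr rfl fun j hj => ?_
    rw [Finset.mem_range] at hj
    simp only [← mul_assoc, ← Finset.sum_mul]
    have := sum_kap_mul_symm (fun i => qq (a + j + i) * qq (b + m - i)) N
    rw [sum_sg_qq _ _ _ (by omega) (by omega)] at this
    have e : ∑ i ∈ Finset.range (N + 1), (kap i : QRing) *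
        (qq (a + i + j) * qq (b - i + m) + qq (a - i + j) * qq (b + i + m)) =
        2 * if a + j + (b + m) = 0 then (sg (a + j) : QRing) else 0 := by
      rw [← this]
      refine Finset.sum_congr rfl fun i _ => ?_
      simp only [sub_neg_eq_add, ← sub_eq_add_neg]
      rw [add_right_comm, sub_add_eq_add_sub, sub_add_eq_add_sub, add_right_comm b]
    rw [e]
    by_cases h : (j + m : ℤ) = -(a + b)
    · rw [if_pos h, if_pos (by omega), sg_add, sg_natCast]; push_cast; ring
    · rw [if_neg h, if_neg (by omega)]; ring
  rw [Finset.sum_congr rfl h2]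
  simp only [← Finset.mul_sum]
  rcases lt_or_ge 0 (a + b) with h | h
  · rw [if_neg h.ne', Finset.sum_eq_zero, mul_zero]
    exact fun m _ => Finset.sum_eq_zero fun j _ => if_neg (by omega)
  -- What is left is the composition of two opposite translations.
  · obtain ⟨n, hn⟩ := Int.eq_ofNat_of_zero_le (neg_nonneg.2 h)
    have h3 := sum_tauC_tauC n γ
    have h4 : ∑ m ∈ Finset.range D, ∑ j ∈ Finset.range D,
        (if (j + m : ℤ) = -(a + b) then (-1) ^ j * tauC j (tauC m γ) else 0) =
        ∑ p ∈ Finset.HasAntidiagonal.antidiagonal n, (-1) ^ p.2 * tauC p.1 (tauC p.2 γ) := by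
      rw [← Finset.sum_product', ← Finset.sum_filter]
      apply Finset.sum_of_injOn id Function.injective_id.injOn
      · rintro ⟨x, y⟩ hx
        simp only [Finset.coe_filter, Set.mem_ofPred_eq, id, Finset.mem_coe,
          Finset.HasAntidiagonal.mem_antidiagonal] at hx ⊢
        omega
      · rintro ⟨x, y⟩ hx hni
        simp only [Finset.HasAntidiagonal.mem_antidiagonal] at hx
        simp only [id, Set.image_id', Finset.coe_filter, Finset.mem_product, Finset.mem_range,
          Set.mem_ofPred_eq] at hni
        rcases lt_or_ge y D with hy | hy
        · rw [hD2 y x (by by_contra hh; exact hni ⟨⟨by omega, by omega⟩, by omega⟩)]; simp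
        · rw [hD y hy]; simp [tauC]
      · rintro ⟨x, y⟩ hx
        rw [id, tauC_comm]
    rw [h4, h3]
    by_cases hn0 : n = 0
    · rw [if_pos hn0, if_pos (by omega)]
    · rw [if_neg hn0, if_neg (by omega), mul_zero]

/-- The modes of `Q(-z) * B(z)` at positive powers of `z` vanish, and its constant term is the
identity. -/
lemma sum_qq_vop (n : ℕ) (γ : QRing) : ∃ N₀ : ℕ, ∀ N, N₀ ≤ N →
    ∑ j ∈ Finset.range N, (-1) ^ j * qq j * vop (n - j) γ = if n = 0 then γ else 0 := by
  obtain ⟨D, hD⟩ := exists_bound_tauC γ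
  refine ⟨n + D + 1, fun N hN => ?_⟩
  simp only [vop_eq_sum_range _ γ D hD, Finset.mul_sum]
  rw [Finset.sum_comm]
  have : ∀ k ∈ Finset.range D, ∑ j ∈ Finset.range N,
      (-1) ^ j * qq j * (qq (n - j + k) * tauC k γ) = if n + k = 0 then tauC k γ else 0 := by
    intro k hk
    rw [Finset.mem_range] at hk
    simp only [← mul_assoc, ← Finset.sum_mul]
    -- `Q(-z) * Q(z) = 1` leaves only `n + k = 0`.
    have h1 := sum_antidiagonal_qq (n + k)
    rw [Finset.Nat.sum_antidiagonal_eq_sum_range_succ (fun i j => (-1) ^ i * (qq i * qq j))] at h1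
    have h2 : ∑ j ∈ Finset.range N, (-1) ^ j * qq j * qq (n - j + k) =
        ∑ j ∈ Finset.range (n + k).succ, (-1) ^ j * (qq j * qq (n + k - j : ℕ)) := by
      symm
      apply Finset.sum_subset_zero_on_sdiff
      · intro x; simp only [Finset.mem_range]; omega
      · intro x hx
        simp only [Finset.mem_sdiff, Finset.mem_range] at hx
        rw [qq_of_neg (n := n - x + k) (by omega), mul_zero]
      · intro x hx
        rw [Finset.mem_range] at hx
        rw [show ((n + k - x : ℕ) : ℤ) = n - x + k by omega, mul_assoc]
    rw [h2, h1]
    split_ifs <;> simp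
  rw [Finset.sum_congr rfl this]
  rcases n with _ | n
  · rcases D with _ | D
    · have := hD 0 le_rfl
      rw [tauC_zero] at this
      simp [this]
    · simp [tauC_zero]
  · simp

/-! ### Vacuum states of neutral fermions -/

/-- A functional on words `φ_{l_1} φ_{l_2} ⋯` in neutral fermions with the anticommutation relations
`φ_a φ_b + φ_b φ_a = 2 (-1) ^ a δ_{a + b, 0}`, such as `⟨L| φ_{l_1} φ_{l_2} ⋯ |0⟩` for a
vacuum vector with `φ_m |0⟩ = 0` for `m < 0` and `φ_0 |0⟩ = |0⟩`. -/
structure IsVacuumState {R : Type*} [CommRing R] (f : List ℤ → R) : Prop where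
  anticomm : ∀ p s a b, f (p ++ a :: b :: s) + f (p ++ b :: a :: s) =
    if a + b = 0 then 2 * (sg a : R) * f (p ++ s) else 0
  last_neg : ∀ p m, m < 0 → f (p ++ [m]) = 0
  last_zero : ∀ p, f (p ++ [0]) = f p

/-- The element `B_{l_1} B_{l_2} ⋯ 1`. -/
def bprod (l : List ℤ) : QRing := l.foldr vop 1

@[simp] lemma bprod_nil : bprod [] = 1 := rfl

@[simp] lemma bprod_cons (a : ℤ) (l : List ℤ) : bprod (a :: l) = vop a (bprod l) := rfl

lemma isVacuumState_bprod : IsVacuumState bprod where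
  anticomm p s a b := by
    induction p with
    | nil => exact vop_anticomm a b (bprod s)
    | cons c p ih =>
      simp only [List.cons_append, bprod_cons]
      rw [← vop_add, ih]
      split_ifs
      · have := map_zsmul (vopHom c) (2 * sg a) (bprod (p ++ s))
        simpa only [zsmul_eq_mul, Int.cast_mul, Int.cast_ofNat, vopHom_apply] using this
      · exact map_zero (vopHom c)
  last_neg p m hm := by
    induction p with
    | nil => simp [vop_one, qq_of_neg hm]
    | cons c p ih => simpa [ih] using map_zero (vopHom c)
  last_zero p := by
    induction p with
    | nil => simp [vop_one]
    | cons c p ih => simp [ih]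

section
variable {R : Type*} [CommRing R]

/-- The vacuum state `l ↦ B_{l_1} B_{l_2} ⋯ 1` specialized along a ring homomorphism. -/
def qState (ev : QRing →+* R) (l : List ℤ) : R := ev (bprod l)

lemma isVacuumState_qState (ev : QRing →+* R) : IsVacuumState (qState ev) where
  anticomm p s a b := by
    have := congrArg ev (isVacuumState_bprod.anticomm p s a b)
    rw [map_add] at this
    simp only [qState, this]
    split_ifs <;> simp [map_ofNat]
  last_neg p m hm := by simp [qState, isVacuumState_bprod.last_neg p m hm]
  last_zero p := by simp [qState, isVacuumState_bprod.last_zero p]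

/-- The annihilation property `sum_qq_vop` after specialization. -/
lemma sum_qq_qState (ev : QRing →+* R) (n : ℕ) (l : List ℤ) : ∃ N₀ : ℕ, ∀ N, N₀ ≤ N →
    ∑ j ∈ Finset.range N, (-1) ^ j * ev (qq j) * qState ev ((n - j : ℤ) :: l) =
      if n = 0 then qState ev l else 0 := by
  obtain ⟨N₀, h⟩ := sum_qq_vop n (bprod l)
  refine ⟨N₀, fun N hN => ?_⟩
  have := congrArg ev (h N hN)
  simp only [map_sum, map_mul, map_pow, map_neg, map_one] at this
  simp only [qState, bprod_cons, this]
  split_ifs <;> simp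

/-- Permuting the creation operators next to the vacuum changes every vacuum state by the same
sign. -/
lemma exists_sign_of_perm {l₁ l₂ : List ℤ} (h : l₁.Perm l₂) (hpos : ∀ x ∈ l₁, 0 < x) :
    ∃ ε : ℤ, ε * ε = 1 ∧ ∀ f : List ℤ → R, IsVacuumState f → ∀ p, f (p ++ l₁) = ε * f (p ++ l₂) := by
  induction h with
  | nil => exact ⟨1, by simp, fun f _ p => by simp⟩
  | cons x h ih =>
    obtain ⟨ε, h1, h2⟩ := ih fun y hy => hpos y (List.mem_cons_of_mem _ hy)
    refine ⟨ε, h1, fun f hf p => ?_⟩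
    simpa using h2 f hf (p ++ [x])
  | swap x y l =>
    refine ⟨-1, by simp, fun f hf p => ?_⟩
    have h1 := hf.anticomm p l y x
    rw [if_neg] at h1
    · push_cast; linear_combination h1
    · have := hpos x (by simp); have := hpos y (by simp); omega
  | trans h12 h23 ih1 ih2 =>
    obtain ⟨ε, h1, h2⟩ := ih1 hpos
    obtain ⟨ε', h1', h2'⟩ := ih2 fun y hy => hpos y (h12.mem_iff.2 hy)
    refine ⟨ε * ε', by rw [mul_mul_mul_comm, h1, h1', one_mul], fun f hf p => ?_⟩
    rw [h2 f hf p, h2' f hf p]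
    push_cast; ring

namespace IsVacuumState
variable {f : List ℤ → R} (hf : IsVacuumState f)
include hf

/-- Moving `φ_u` to the right through `w`. -/
lemma contract (u : ℤ) (w p s : List ℤ) :
    f (p ++ u :: (w ++ s)) = ∑ i ∈ Finset.range w.length,
        (-1) ^ i * ((if u + w.getD i 0 = 0 then 2 * (sg u : R) else 0) *
          f (p ++ (w.eraseIdx i ++ s))) + (-1) ^ w.length * f (p ++ (w ++ u :: s)) := by
  induction w generalizing p with
  | nil => simp
  | cons b w ih =>
    have h1 := hf.anticomm p (w ++ s) u b
    have h2 := ih (p ++ [b])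
    simp only [List.append_assoc, List.cons_append, List.nil_append] at h2
    rw [List.length_cons, Finset.sum_range_succ', List.cons_append,
      eq_sub_of_add_eq h1, h2]
    simp only [List.getD_cons_succ, List.getD_cons_zero, List.eraseIdx_cons_succ,
      List.eraseIdx_cons_zero, List.cons_append, pow_succ, pow_zero, mul_neg_one, neg_mul,
      Finset.sum_neg_distrib, one_mul]
    split_ifs <;> ring

/-- An annihilation operator `φ_{-k}` kills vectors created without `φ_k`. -/
lemma annihilate (k : ℤ) (hk : 0 < k) (p s : List ℤ) (hs : ∀ x ∈ s, x ≠ k) :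
    f (p ++ -k :: s) = 0 := by
  induction s generalizing p with
  | nil => exact hf.last_neg p _ (by omega)
  | cons b s ih =>
    have h1 := hf.anticomm p s (-k) b
    have h2 := ih (p ++ [b]) fun x hx => hs x (List.mem_cons_of_mem _ hx)
    rw [if_neg (by have := hs b (by simp); omega)] at h1
    simp only [List.append_assoc, List.cons_append, List.nil_append] at h2
    rwa [h2, add_zero] at h1

lemma repeat_eq_zero [Algebra ℚ R] (k : ℤ) (hk : k ≠ 0) (p s : List ℤ) :
    f (p ++ k :: k :: s) = 0 := by
  have h1 := hf.anticomm p s k k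
  rw [if_neg (by omega), ← two_smul ℚ] at h1
  simpa using congrArg (fun x => (1 / 2 : ℚ) • x) h1

end IsVacuumState
end

/-! ### Words of strict partitions -/

/-- The list of the parts of a strict partition in decreasing order. -/
def word (lam : StrictPartition) : List ℤ := List.ofFn (part lam)

lemma mem_word {lam : StrictPartition} {x : ℤ} : x ∈ word lam ↔ ∃ k ∈ lam, ((k : ℕ+) : ℤ) = x := by
  simp only [word, List.mem_ofFn, part]
  constructor
  · rintro ⟨i, rfl⟩
    exact ⟨_, Finset.orderEmbOfFin_mem _ _ _, rfl⟩
  · rintro ⟨k, hk, rfl⟩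
    rw [← Finset.mem_coe, ← Finset.range_orderEmbOfFin lam rfl] at hk
    obtain ⟨i, rfl⟩ := hk
    exact ⟨i.rev, by rw [Fin.rev_rev]⟩

lemma nodup_word (lam : StrictPartition) : (word lam).Nodup := by
  rw [word, List.nodup_ofFn]
  intro i j h
  simp only [part] at h
  have h' : (lam.orderEmbOfFin rfl i.rev : ℕ+) = lam.orderEmbOfFin rfl j.rev :=
    PNat.coe_injective (by exact_mod_cast h)
  exact Fin.rev_injective ((lam.orderEmbOfFin rfl).injective h')

lemma pnat_cast_mem_word {lam : StrictPartition} {k : ℕ+} : (k : ℤ) ∈ word lam ↔ k ∈ lam := by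
  simp [mem_word]

lemma pos_of_mem_word {lam : StrictPartition} {x : ℤ} (h : x ∈ word lam) : 0 < x := by
  obtain ⟨k, _, rfl⟩ := mem_word.1 h
  exact_mod_cast k.pos

lemma word_insert_perm {lam : StrictPartition} {k : ℕ+} (hk : k ∉ lam) :
    (word (insert k lam)).Perm ((k : ℤ) :: word lam) := by
  rw [List.perm_ext_iff_of_nodup (nodup_word _)
    (List.nodup_cons.2 ⟨by rwa [pnat_cast_mem_word], nodup_word _⟩)]
  intro x
  simp only [mem_word, List.mem_cons, Finset.mem_insert]
  constructor
  · rintro ⟨m, rfl | hm, rfl⟩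
    · exact Or.inl rfl
    · exact Or.inr ⟨m, hm, rfl⟩
  · rintro (rfl | ⟨m, hm, rfl⟩)
    · exact ⟨k, Or.inl rfl, rfl⟩
    · exact ⟨m, Or.inr hm, rfl⟩

lemma exists_sign_insert (R : Type*) [CommRing R] {lam : StrictPartition} {k : ℕ+} (hk : k ∉ lam) :
    ∃ ε : ℤ, ε * ε = 1 ∧ ∀ f : List ℤ → R, IsVacuumState f → ∀ p,
      f (p ++ word (insert k lam)) = ε * f (p ++ (k : ℤ) :: word lam) :=
  exists_sign_of_perm (word_insert_perm hk) fun _ hx => pos_of_mem_word hx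

/-- The word `k_1 ⋯ k_n (-k_n) ⋯ (-k_1)`. -/
def nested : List ℤ → List ℤ
  | [] => []
  | k :: l => k :: (nested l ++ [-k])

namespace IsVacuumState
variable {R : Type*} [CommRing R] {f : List ℤ → R} (hf : IsVacuumState f)
include hf

lemma neg_word {lam : StrictPartition} {k : ℕ+} (hk : k ∉ lam) (p : List ℤ) :
    f (p ++ -(k : ℤ) :: word lam) = 0 :=
  hf.annihilate _ (by exact_mod_cast k.pos) _ _ fun x hx hxk =>
    hk (pnat_cast_mem_word.1 (hxk ▸ hx))

lemma neg_pos_word {lam : StrictPartition} {k : ℕ+} (hk : k ∉ lam) (p : List ℤ) :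
    f (p ++ -(k : ℤ) :: (k : ℤ) :: word lam) = 2 * (sg k : R) * f (p ++ word lam) := by
  have h1 := hf.anticomm p (word lam) (-(k : ℤ)) k
  have h2 := hf.neg_word hk (p ++ [(k : ℤ)])
  simp only [List.append_assoc, List.cons_append, List.nil_append] at h2
  rw [h2, add_zero, if_pos (by omega), sg_neg] at h1
  exact h1

lemma pos_word [Algebra ℚ R] {lam : StrictPartition} {k : ℕ+} (hk : k ∈ lam) (p : List ℤ) :
    f (p ++ (k : ℤ) :: word lam) = 0 := by
  obtain ⟨ε, -, h⟩ := exists_sign_insert R (Finset.notMem_erase k lam)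
  have h1 := h f hf (p ++ [(k : ℤ)])
  rw [Finset.insert_erase hk] at h1
  have h2 := hf.repeat_eq_zero k (by exact_mod_cast k.ne_zero) p (word (lam.erase k))
  simp only [List.append_assoc, List.cons_append, List.nil_append] at h1
  rw [h1, h2, mul_zero]

/-- The product of the `φ_k φ_{-k}` is, up to a constant, the projection onto the strict partitions
containing all the `k`. -/
lemma nested_word (l : List ℕ+) (hl : l.Nodup) (lam : StrictPartition) (p : List ℤ) :
    f (p ++ (nested (l.map fun k : ℕ+ => (k : ℤ)) ++ word lam)) =
      if ∀ k ∈ l, k ∈ lam then (((l.map fun k : ℕ+ => 2 * sg (k : ℤ)).prod : ℤ) : R) * f (p ++ word lam)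
      else 0 := by
  induction l generalizing lam p with
  | nil => simp [nested]
  | cons k l ih =>
    simp only [List.map_cons, nested, List.cons_append, List.append_assoc, List.nil_append]
    by_cases hk : k ∈ lam
    · obtain ⟨ε, hε, h⟩ := exists_sign_insert R (Finset.notMem_erase k lam)
      have h' := h f hf
      rw [Finset.insert_erase hk] at h'
      have h1 := h' (p ++ (k : ℤ) :: (nested (l.map fun k : ℕ+ => (k : ℤ)) ++ [-(k : ℤ)]))
      have h2 := hf.neg_pos_word (Finset.notMem_erase k lam)
        (p ++ (k : ℤ) :: nested (l.map fun k : ℕ+ => (k : ℤ)))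
      have h3 := ih (List.nodup_cons.1 hl).2 (lam.erase k) (p ++ [(k : ℤ)])
      simp only [List.append_assoc, List.cons_append, List.nil_append] at h1 h2 h3
      rw [h1, h2, h3, h' p]
      have e : (∀ m ∈ l, m ∈ lam.erase k) ↔ ∀ m ∈ k :: l, m ∈ lam := by
        simp only [Finset.mem_erase, List.mem_cons, forall_eq_or_imp, hk, true_and]
        refine forall₂_congr fun m hm => ⟨fun h => h.2, fun h => ⟨?_, h⟩⟩
        rintro rfl
        exact (List.nodup_cons.1 hl).1 hm
      simp only [e]
      split_ifs
      · rw [List.prod_cons]; push_cast; ring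
      · ring
    · rw [if_neg fun h => hk (h k (by simp))]
      have h2 := hf.neg_word hk (p ++ (k : ℤ) :: nested (l.map fun k : ℕ+ => (k : ℤ)))
      simpa only [List.append_assoc, List.cons_append, List.nil_append] using h2

end IsVacuumState

/-! ### Schur `Q`-functions as iterated vertex operators -/

/-- The exponent of `z_i` left over for `Q(z_i)` in the term of index `a`. -/
def expo {m : ℕ} (l : Fin m → ℤ) (a : Pairs m → ℕ) (i : Fin m) : ℤ :=
  l i + (∑ p : Pairs m, if p.1.1 = i then (a p : ℤ) else 0)
        - ∑ p : Pairs m, if p.1.2 = i then (a p : ℤ) else 0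

lemma sum_expo {m : ℕ} (l : Fin m → ℤ) (a : Pairs m → ℕ) : ∑ i, expo l a i = ∑ i, l i := by
  simp only [expo, Finset.sum_sub_distrib, Finset.sum_add_distrib]
  rw [Finset.sum_comm, Finset.sum_comm (γ := Fin m) (s := Finset.univ (α := Fin m))]
  simp

/-- If no exponent is negative, then the indices are bounded. -/
lemma le_of_expo_nonneg {m : ℕ} (l : Fin m → ℤ) (a : Pairs m → ℕ) (h : ∀ i, 0 ≤ expo l a i)
    (p : Pairs m) : (a p : ℤ) ≤ ∑ i, |l i| := by
  classical
  -- Add up the exponents of index at least `p.1.2`: the pairs with both or no members in this range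
  -- cancel, while `a p` enters with a minus sign.
  set s := Finset.univ.filter fun i : Fin m => p.1.2 ≤ i with hs
  have h1 : 0 ≤ ∑ i ∈ s, expo l a i := Finset.sum_nonneg fun i _ => h i
  have h2 : ∑ i ∈ s, l i ≤ ∑ i, |l i| :=
    (Finset.sum_le_sum fun i _ => le_abs_self (l i)).trans
      (Finset.sum_le_sum_of_subset_of_nonneg (Finset.subset_univ s) fun i _ _ => abs_nonneg _)
  have h3 : ∑ i ∈ s, expo l a i = ∑ i ∈ s, l i +
      ∑ r : Pairs m, ((if p.1.2 ≤ r.1.1 then (a r : ℤ) else 0) -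
        (if p.1.2 ≤ r.1.2 then (a r : ℤ) else 0)) := by
    simp only [expo, Finset.sum_sub_distrib, Finset.sum_add_distrib]
    rw [Finset.sum_comm, Finset.sum_comm (s := s)]
    simp only [Finset.sum_ite_eq, hs, Finset.mem_filter, Finset.mem_univ, true_and]
    ring
  have h4 : ∑ r : Pairs m, ((if p.1.2 ≤ r.1.1 then (a r : ℤ) else 0) -
        (if p.1.2 ≤ r.1.2 then (a r : ℤ) else 0)) ≤ -(a p : ℤ) := by
    rw [← Finset.add_sum_erase _ _ (Finset.mem_univ p)]
    have h5 : ∑ r ∈ Finset.univ.erase p, ((if p.1.2 ≤ r.1.1 then (a r : ℤ) else 0) -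
        (if p.1.2 ≤ r.1.2 then (a r : ℤ) else 0)) ≤ 0 := by
      apply Finset.sum_nonpos
      intro r _
      have := r.2
      split_ifs with h6 h7
      · omega
      · exact absurd (h6.trans this.le) h7
      · omega
      · omega
    rw [if_neg (not_le.2 p.2), if_pos le_rfl]
    omega
  omega

/-- The term of index `a` in the expansion of a coefficient of
`∏ Q(z_i) * ∏_{i < j} (z_i - z_j) / (z_i + z_j)`, for the universal series `Q(z)`. -/
def univTerm {m : ℕ} (l : Fin m → ℤ) (a : Pairs m → ℕ) : QRing :=
  (∏ p : Pairs m, (kap (a p) : QRing)) * ∏ i : Fin m, qq (expo l a i)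

lemma finite_bounded {ι : Type*} [Finite ι] (N : ℤ) : {a : ι → ℕ | ∀ i, (a i : ℤ) ≤ N}.Finite := by
  have := Fintype.ofFinite ι
  refine (Set.Finite.pi' (t := fun _ : ι => {n : ℕ | (n : ℤ) ≤ N}) fun _ => ?_).subset
    fun a ha => ha
  exact (Set.finite_Iic N.toNat).subset fun n hn => by simp only [Set.mem_ofPred_eq] at hn; simp; omega

lemma finite_expo_nonneg {m : ℕ} (l : Fin m → ℤ) :
    {a : Pairs m → ℕ | ∀ i, 0 ≤ expo l a i}.Finite :=
  (finite_bounded _).subset fun a ha p => le_of_expo_nonneg l a ha p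

lemma finite_support_univTerm {m : ℕ} (l : Fin m → ℤ) :
    (Function.support (univTerm l)).Finite := by
  refine (finite_expo_nonneg l).subset fun a ha i => ?_
  by_contra hi
  exact ha (mul_eq_zero_of_right _ (Finset.prod_eq_zero (Finset.mem_univ i)
    (qq_of_neg (not_le.1 hi))))

/-- A term of the expansion of `B_a` applied to a product of generators. -/
def vopTerm {m : ℕ} (a : ℤ) (n : Fin m → ℤ) (e : Fin m → ℕ) : QRing :=
  (∏ i, (kap (e i) : QRing)) * (qq (a + ∑ i, (e i : ℤ)) * ∏ i, qq (n i - e i))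

lemma finite_support_vopTerm {m : ℕ} (a : ℤ) (n : Fin m → ℤ) :
    (Function.support (vopTerm a n)).Finite := by
  refine (finite_bounded (∑ i, |n i|)).subset fun e he i => ?_
  by_contra hi
  have h1 : |n i| ≤ ∑ i, |n i| := Finset.single_le_sum (fun i _ => abs_nonneg (n i)) (Finset.mem_univ i)
  have h2 := le_abs_self (n i)
  exact he (mul_eq_zero_of_right _ (mul_eq_zero_of_right _ (Finset.prod_eq_zero (Finset.mem_univ i)
    (qq_of_neg (by omega)))))

lemma prod_monomial {ι : Type*} (s : Finset ι) (e : ι → ℕ) (c : ι → QRing) :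
    ∏ i ∈ s, Polynomial.monomial (e i) (c i) =
      Polynomial.monomial (∑ i ∈ s, e i) (∏ i ∈ s, c i) := by
  classical
  induction s using Finset.induction_on with
  | empty => simp
  | insert i s hi ih =>
    rw [Finset.prod_insert hi, Finset.prod_insert hi, Finset.sum_insert hi, ih,
      Polynomial.monomial_mul_monomial]

lemma vop_prod_qq {m : ℕ} (a : ℤ) (n : Fin m → ℤ) :
    vop a (∏ i, qq (n i)) = ∑ᶠ e, vopTerm a n e := by
  classical
  obtain ⟨N, hN⟩ : ∃ N : ℕ, ∑ i, |n i| < N := ⟨(∑ i, |n i|).toNat + 1, by push_cast; omega⟩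
  have hn : ∀ i, n i < N := fun i =>
    ((le_abs_self _).trans (Finset.single_le_sum (fun i _ => abs_nonneg (n i))
      (Finset.mem_univ i))).trans_lt hN
  rw [finsum_eq_sum_of_support_subset (s := Fintype.piFinset fun _ => Finset.range N)]
  · rw [vop, map_prod, Finset.prod_congr rfl fun i _ => tau_qq_eq (n i) N (hn i),
      Finset.prod_univ_sum, extr_sum]
    refine Finset.sum_congr rfl fun e _ => ?_
    rw [prod_monomial, extr_monomial, Finset.prod_mul_distrib, vopTerm]
    push_cast; ring
  · intro e he
    simp only [Finset.mem_coe, Fintype.mem_piFinset, Finset.mem_range]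
    intro i
    by_contra hi
    have := hn i
    exact he (mul_eq_zero_of_right _ (mul_eq_zero_of_right _ (Finset.prod_eq_zero
      (Finset.mem_univ i) (qq_of_neg (by omega)))))

/-- The pairs in `Fin (m + 1)` are those containing `0` and those of the remaining indices. -/
def pairsSuccEquiv (m : ℕ) : Fin m ⊕ Pairs m ≃ Pairs (m + 1) where
  toFun := Sum.elim (fun i => ⟨(0, i.succ), Fin.succ_pos i⟩)
    fun p => ⟨(p.1.1.succ, p.1.2.succ), Fin.succ_lt_succ_iff.2 p.2⟩
  invFun p := if h : p.1.1 = 0 then Sum.inl (p.1.2.pred (by have := p.2; rintro h'; simp [h'] at this))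
    else Sum.inr ⟨(p.1.1.pred h, p.1.2.pred (by have := p.2; rintro h'; simp [h'] at this)),
      by simpa using p.2⟩
  left_inv x := by rcases x with i | p <;> simp
  right_inv p := by
    rcases p with ⟨⟨i, j⟩, hij⟩
    by_cases h : i = 0
    · subst h; simp
    · simp [h]

/-- The corresponding decomposition of families of natural numbers indexed by pairs. -/
def pairsFunEquiv (m : ℕ) : (Pairs m → ℕ) × (Fin m → ℕ) ≃ (Pairs (m + 1) → ℕ) :=
  (Equiv.prodComm _ _).trans
    ((Equiv.sumArrowEquivProdArrow _ _ _).symm.trans ((pairsSuccEquiv m).arrowCongr (Equiv.refl ℕ)))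

lemma pairsFunEquiv_apply {m : ℕ} (x : (Pairs m → ℕ) × (Fin m → ℕ)) (y : Fin m ⊕ Pairs m) :
    pairsFunEquiv m x (pairsSuccEquiv m y) = Sum.elim x.2 x.1 y := by
  simp [pairsFunEquiv, Equiv.arrowCongr, Equiv.sumArrowEquivProdArrow]

lemma univTerm_succ {m : ℕ} (l : Fin (m + 1) → ℤ) (x : (Pairs m → ℕ) × (Fin m → ℕ)) :
    univTerm l (pairsFunEquiv m x) =
      (∏ p, (kap (x.1 p) : QRing)) * vopTerm (l 0) (expo (fun i => l i.succ) x.1) x.2 := by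
  have h0 : expo l (pairsFunEquiv m x) 0 = l 0 + ∑ i, (x.2 i : ℤ) := by
    simp only [expo]
    rw [← (pairsSuccEquiv m).sum_comp, ← (pairsSuccEquiv m).sum_comp]
    simp only [pairsFunEquiv_apply, Fintype.sum_sum_type]
    simp [pairsSuccEquiv]
  have h1 : ∀ i : Fin m, expo l (pairsFunEquiv m x) i.succ =
      expo (fun i => l i.succ) x.1 i - x.2 i := by
    intro i
    simp only [expo]
    rw [← (pairsSuccEquiv m).sum_comp, ← (pairsSuccEquiv m).sum_comp]
    simp only [pairsFunEquiv_apply, Fintype.sum_sum_type]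
    simp [pairsSuccEquiv, (Fin.succ_ne_zero i).symm]
    ring
  rw [univTerm, vopTerm, Fin.prod_univ_succ, h0]
  simp only [h1]
  rw [← (pairsSuccEquiv m).prod_comp]
  simp only [pairsFunEquiv_apply, Fintype.prod_sum_type, Sum.elim_inl, Sum.elim_inr]
  ring

/-- The coefficient of `∏ z_i ^ (l i)` in `∏ Q(z_i) * ∏_{i < j} (z_i - z_j) / (z_i + z_j)` is
`B_{l_0} B_{l_1} ⋯ 1`. -/
lemma bprod_ofFn {m : ℕ} (l : Fin m → ℤ) : bprod (List.ofFn l) = ∑ᶠ a, univTerm l a := by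
  induction m with
  | zero =>
    rw [List.ofFn_zero, bprod_nil, finsum_eq_sum_of_fintype, Fintype.sum_unique]
    simp [univTerm]
  | succ m ih =>
    rw [List.ofFn_succ, bprod_cons, ih, ← vopHom_apply,
      AddMonoidHom.map_finsum _ (finite_support_univTerm _), ← finsum_comp_equiv (pairsFunEquiv m),
      finsum_curry]
    · refine finsum_congr fun A => ?_
      simp only [univTerm_succ]
      rw [← mul_finsum' _ _ (finite_support_vopTerm _ _), ← vop_prod_qq, vopHom_apply, univTerm]
      have h : (∏ p : Pairs m, (kap (A p) : QRing)) = ((∏ p : Pairs m, kap (A p) : ℤ) : QRing) := by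
        push_cast; rfl
      rw [h]
      have := map_zsmul (vopHom (l 0)) (∏ p : Pairs m, kap (A p))
        (∏ i, qq (expo (fun i => l i.succ) A i))
      simpa only [zsmul_eq_mul, vopHom_apply] using this
    · exact (finite_support_univTerm l).preimage (pairsFunEquiv m).injective.injOn

/-! ### Degrees and convergence in `SeriesXY` -/

/-- The series `f` has no terms of total degree less than `n`. -/
def Lo (n : ℤ) (f : SeriesXY) : Prop := ∀ d, (d.degree : ℤ) < n → MvPowerSeries.coeff d f = 0

/-- The series `f` is homogeneous of total degree `n`; in particular it vanishes if `n < 0`. -/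
def IsHom (n : ℤ) (f : SeriesXY) : Prop :=
  ∀ d, (d.degree : ℤ) ≠ n → MvPowerSeries.coeff d f = 0

lemma IsHom.lo {n : ℤ} {f : SeriesXY} (h : IsHom n f) : Lo n f := fun d hd => h d hd.ne

lemma IsHom.eq_zero {n : ℤ} {f : SeriesXY} (h : IsHom n f) (hn : n < 0) : f = 0 := by
  ext d
  rw [h d (by omega), map_zero]

lemma lo_zero (n : ℤ) : Lo n 0 := fun _ _ => map_zero _

lemma Lo.mono {m n : ℤ} {f : SeriesXY} (h : Lo n f) (hmn : m ≤ n) : Lo m f :=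
  fun d hd => h d (hd.trans_le hmn)

lemma Lo.mul {m n : ℤ} {f g : SeriesXY} (hf : Lo m f) (hg : Lo n g) : Lo (m + n) (f * g) := by
  classical
  intro d hd
  rw [MvPowerSeries.coeff_mul]
  refine Finset.sum_eq_zero fun p hp => ?_
  rw [Finset.HasAntidiagonal.mem_antidiagonal] at hp
  have h1 : p.1.degree + p.2.degree = d.degree := by rw [← hp, map_add]
  rcases lt_or_ge (p.1.degree : ℤ) m with h | h
  · rw [hf _ h, zero_mul]
  · rw [hg p.2 (by omega), mul_zero]

lemma IsHom.mul {m n : ℤ} {f g : SeriesXY} (hf : IsHom m f) (hg : IsHom n g) :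
    IsHom (m + n) (f * g) := by
  classical
  intro d hd
  rw [MvPowerSeries.coeff_mul]
  refine Finset.sum_eq_zero fun p hp => ?_
  rw [Finset.HasAntidiagonal.mem_antidiagonal] at hp
  have h1 : p.1.degree + p.2.degree = d.degree := by rw [← hp, map_add]
  by_cases h : (p.1.degree : ℤ) = m
  · rw [hg p.2 (by omega), mul_zero]
  · rw [hf _ h, zero_mul]

lemma isHom_C (c : ℚ) : IsHom 0 (MvPowerSeries.C c) := by
  classical
  intro d hd
  rw [MvPowerSeries.coeff_C, if_neg]
  rintro rfl
  simp at hd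

lemma isHom_one : IsHom 0 1 := by simpa using isHom_C 1

lemma isHom_intCast (n : ℤ) : IsHom 0 (n : SeriesXY) := by
  simpa using isHom_C n

lemma isHom_X (s : ℕ ⊕ ℕ) : IsHom 1 (MvPowerSeries.X s) := by
  classical
  intro d hd
  rw [MvPowerSeries.coeff_X, if_neg]
  rintro rfl
  simp at hd

lemma isHom_pow {n : ℤ} {f : SeriesXY} (hf : IsHom n f) (k : ℕ) : IsHom (k * n) (f ^ k) := by
  induction k with
  | zero => simpa using isHom_one
  | succ k ih =>
    rw [pow_succ]
    have := ih.mul hf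
    convert this using 1
    push_cast; ring

lemma IsHom.sg_mul {n : ℤ} {f : SeriesXY} (hf : IsHom n f) (k : ℤ) :
    IsHom n ((sg k : SeriesXY) * f) := by
  simpa using (isHom_intCast (sg k)).mul hf

lemma IsHom.add {n : ℤ} {f g : SeriesXY} (hf : IsHom n f) (hg : IsHom n g) : IsHom n (f + g) :=
  fun d hd => by rw [map_add, hf d hd, hg d hd, add_zero]

lemma isHom_zero (n : ℤ) : IsHom n 0 := fun _ _ => map_zero _

lemma isHom_sum {ι : Type*} (s : Finset ι) (n : ℤ) (f : ι → SeriesXY) (h : ∀ i ∈ s, IsHom n (f i)) :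
    IsHom n (∑ i ∈ s, f i) :=
  Finset.sum_induction _ (IsHom n) (fun _ _ => IsHom.add) (isHom_zero n) h

lemma isHom_prod {ι : Type*} (s : Finset ι) (n : ι → ℤ) (f : ι → SeriesXY)
    (h : ∀ i ∈ s, IsHom (n i) (f i)) : IsHom (∑ i ∈ s, n i) (∏ i ∈ s, f i) := by
  classical
  induction s using Finset.induction_on with
  | empty => simpa using isHom_one
  | insert i s hi ih =>
    rw [Finset.prod_insert hi, Finset.sum_insert hi]
    exact (h i (by simp)).mul (ih fun j hj => h j (Finset.mem_insert_of_mem hj))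

/-- A family is summable if its terms of bounded degree come from finitely many members. -/
lemma summable_of_lo {ι : Type*} {t : ι → SeriesXY} (v : ι → ℤ) (h : ∀ i, Lo (v i) (t i))
    (hv : ∀ n, {i | v i ≤ n}.Finite) : Summable t := by
  rw [MvPowerSeries.WithPiTopology.summable_iff_summable_coeff]
  intro d
  refine summable_of_hasFiniteSupport ((hv d.degree).subset fun i hi => ?_)
  by_contra hn
  exact hi (h i d (not_le.1 hn))

lemma Lo.tsum {ι : Type*} {t : ι → SeriesXY} {n : ℤ} (h : ∀ i, Lo n (t i)) : Lo n (∑' i, t i) := by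
  intro d hd
  by_cases hs : Summable t
  · rw [← ((MvPowerSeries.WithPiTopology.hasSum_iff_hasSum_coeff.1 hs.hasSum) d).tsum_eq]
    simp [fun i => h i d hd]
  · rw [tsum_eq_zero_of_not_summable hs, map_zero]

/-! ### The generating series `Q_x(z)` -/

lemma mul_invOfUnit_factor (x : SeriesXY) :
    (1 - PowerSeries.C x * PowerSeries.X) *
      PowerSeries.invOfUnit (1 - PowerSeries.C x * PowerSeries.X) 1 = 1 :=
  PowerSeries.mul_invOfUnit _ _ (by simp)

lemma factor_mul_evalNeg (x : SeriesXY) :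
    factor x * PowerSeries.evalNegHom (factor x) = 1 := by
  have h := mul_invOfUnit_factor x
  have h' := congrArg PowerSeries.evalNegHom h
  have hC : PowerSeries.evalNegHom (PowerSeries.C x) = PowerSeries.C x := by
    ext n
    simp only [PowerSeries.evalNegHom, PowerSeries.coeff_rescale, PowerSeries.coeff_C]
    split_ifs with hn <;> simp [hn]
  unfold factor
  simp only [map_mul, map_add, map_sub, map_one, PowerSeries.evalNegHom_X, hC] at h' ⊢
  linear_combination (1 + PowerSeries.C x * PowerSeries.X) *
    PowerSeries.evalNegHom (PowerSeries.invOfUnit (1 - PowerSeries.C x * PowerSeries.X) 1) * h + h'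

lemma coeff_zero_factor (x : SeriesXY) : PowerSeries.coeff 0 (factor x) = 1 := by
  simp [factor]

/-- The coefficient of `z ^ n` in `P` is homogeneous of degree `n` for all `n`. -/
def IsHomSeries (P : PowerSeries SeriesXY) : Prop := ∀ n : ℕ, IsHom n (PowerSeries.coeff n P)

lemma IsHomSeries.mul {P R : PowerSeries SeriesXY} (hP : IsHomSeries P) (hR : IsHomSeries R) :
    IsHomSeries (P * R) := by
  intro n
  rw [PowerSeries.coeff_mul]
  refine isHom_sum _ _ _ fun p hp => ?_
  rw [Finset.HasAntidiagonal.mem_antidiagonal] at hp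
  rw [← hp, Nat.cast_add]
  exact (hP _).mul (hR _)

lemma isHomSeries_one : IsHomSeries 1 := by
  intro n
  rw [PowerSeries.coeff_one]
  split_ifs with h
  · subst h; exact isHom_one
  · exact isHom_zero _

lemma isHomSeries_factor (s : ℕ ⊕ ℕ) : IsHomSeries (factor (MvPowerSeries.X s)) := by
  set x : SeriesXY := MvPowerSeries.X s
  have hx : IsHom 1 x := isHom_X s
  have h1 : PowerSeries.invOfUnit (1 - PowerSeries.C x * PowerSeries.X) 1 =
      PowerSeries.mk fun n => x ^ n := by
    have h2 : (1 - PowerSeries.C x * PowerSeries.X) * PowerSeries.mk (fun n => x ^ n) = 1 := by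
      ext1 n
      rcases n with _ | n
      · simp
      · rw [sub_mul, one_mul, map_sub, mul_assoc, PowerSeries.coeff_C_mul,
          PowerSeries.coeff_succ_X_mul, PowerSeries.coeff_mk, PowerSeries.coeff_mk,
          PowerSeries.coeff_one, if_neg (Nat.succ_ne_zero n), pow_succ']
        ring
    linear_combination (PowerSeries.mk fun n => x ^ n) * mul_invOfUnit_factor x -
      PowerSeries.invOfUnit (1 - PowerSeries.C x * PowerSeries.X) 1 * h2
  have h3 : IsHomSeries (1 + PowerSeries.C x * PowerSeries.X) := by
    intro n
    rw [map_add, PowerSeries.coeff_C_mul, PowerSeries.coeff_one, PowerSeries.coeff_X]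
    rcases n with _ | _ | n
    · simpa using isHom_one
    · simpa using hx
    · simpa using isHom_zero _
  rw [factor, h1]
  refine h3.mul fun n => ?_
  rw [PowerSeries.coeff_mk]
  simpa using isHom_pow hx n

lemma continuous_evalNegHom :
    Continuous (PowerSeries.evalNegHom : PowerSeries SeriesXY → PowerSeries SeriesXY) := by
  rw [continuous_iff_continuousAt]
  intro P
  rw [ContinuousAt, PowerSeries.WithPiTopology.tendsto_iff_coeff_tendsto]
  intro n
  simp only [PowerSeries.evalNegHom, PowerSeries.coeff_rescale]
  exact ((PowerSeries.WithPiTopology.continuous_coeff _ n).tendsto P).const_mul _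

section
variable (v : ℕ → ℕ ⊕ ℕ) (hv : Function.Injective v)
include hv

lemma tendsto_prod_factor : Filter.Tendsto
    (fun s : Finset ℕ => ∏ i ∈ s, factor (MvPowerSeries.X (v i))) Filter.atTop
    (nhds (genQ fun i => MvPowerSeries.X (v i))) :=
  (multipliable_factor v hv).hasProd

lemma genQ_mul_evalNeg :
    genQ (fun i => MvPowerSeries.X (v i)) *
      PowerSeries.evalNegHom (genQ fun i => MvPowerSeries.X (v i)) = 1 := by
  have h := tendsto_prod_factor v hv
  have h2 := h.mul ((continuous_evalNegHom.tendsto _).comp h)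
  refine tendsto_nhds_unique h2 (tendsto_const_nhds.congr fun s => ?_)
  simp only [Function.comp_apply, map_prod, ← Finset.prod_mul_distrib, factor_mul_evalNeg,
    Finset.prod_const_one]

lemma coeff_zero_genQ : PowerSeries.coeff 0 (genQ fun i => MvPowerSeries.X (v i)) = 1 := by
  have h := ((PowerSeries.WithPiTopology.continuous_coeff SeriesXY 0).tendsto _).comp
    (tendsto_prod_factor v hv)
  refine tendsto_nhds_unique h (tendsto_const_nhds.congr fun s => ?_)
  rw [Function.comp_apply, PowerSeries.coeff_zero_eq_constantCoeff_apply, map_prod]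
  refine (Finset.prod_eq_one fun i _ => ?_).symm
  rw [← PowerSeries.coeff_zero_eq_constantCoeff_apply, coeff_zero_factor]

lemma isHomSeries_genQ : IsHomSeries (genQ fun i => MvPowerSeries.X (v i)) := by
  intro n d hd
  have h := ((MvPowerSeries.WithPiTopology.continuous_coeff ℚ d).tendsto _).comp
    (((PowerSeries.WithPiTopology.continuous_coeff SeriesXY n).tendsto _).comp
    (tendsto_prod_factor v hv))
  refine tendsto_nhds_unique h (tendsto_const_nhds.congr fun s => ?_)
  have : IsHomSeries (∏ i ∈ s, factor (MvPowerSeries.X (v i))) :=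
    Finset.prod_induction _ IsHomSeries (fun _ _ => IsHomSeries.mul) isHomSeries_one
      fun i _ => isHomSeries_factor _
  exact (this n d hd).symm

end

/-- A specialization of the universal series `Q(z)` to a series `Q_x(z)` with homogeneous
coefficients. -/
structure IsSpecialization (x : ℕ → SeriesXY) (ev : QRing →+* SeriesXY) : Prop where
  ev_qq : ∀ n, ev (qq n) = coeffInt (genQ x) n
  isHom_qq : ∀ n, IsHom n (ev (qq n))

lemma exists_isSpecialization (v : ℕ → ℕ ⊕ ℕ) (hv : Function.Injective v) :
    ∃ ev, IsSpecialization (fun i => MvPowerSeries.X (v i)) ev := by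
  refine ⟨qLift _ (coeff_zero_genQ v hv) (genQ_mul_evalNeg v hv), fun n => qLift_qq _ _ _ n,
    fun n => ?_⟩
  rw [qLift_qq]
  split_ifs with h
  · lift n to ℕ using h
    exact isHomSeries_genQ v hv n
  · exact isHom_zero _

namespace IsSpecialization
variable {x : ℕ → SeriesXY} {ev : QRing →+* SeriesXY} (hx : IsSpecialization x ev)
include hx

lemma schurQTerm_eq {m : ℕ} (l : Fin m → ℤ) (a : Pairs m → ℕ) :
    schurQTerm x l a = ev (univTerm l a) := by
  simp only [schurQTerm, univTerm, expo, map_mul, map_prod, map_intCast, hx.ev_qq, kernelCoeff_eq]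

lemma finite_support_schurQTerm {m : ℕ} (l : Fin m → ℤ) :
    (Function.support (schurQTerm x l)).Finite := by
  refine (finite_support_univTerm l).subset fun a ha h0 => ha ?_
  rw [hx.schurQTerm_eq, h0, map_zero]

lemma summable_schurQTerm {m : ℕ} (l : Fin m → ℤ) : Summable (schurQTerm x l) :=
  summable_of_hasFiniteSupport (hx.finite_support_schurQTerm l)

lemma schurQ_eq (lam : StrictPartition) : schurQ x lam = qState ev (word lam) := by
  rw [schurQ, tsum_eq_finsum (hx.finite_support_schurQTerm _), qState, word, bprod_ofFn,
    finsum_congr fun a => hx.schurQTerm_eq _ a]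
  exact (ev.toAddMonoidHom.map_finsum (finite_support_univTerm _)).symm

/-- Every term of the expansion has degree `∑ expo l a i = ∑ l i`. -/
lemma isHom_qState (l : List ℤ) : IsHom l.sum (qState ev l) := by
  have hl : l = List.ofFn l.get := (List.ofFn_get l).symm
  rw [hl, qState, bprod_ofFn, List.sum_ofFn, finsum_eq_sum _ (finite_support_univTerm _), map_sum]
  refine isHom_sum _ _ _ fun a _ => ?_
  rw [univTerm, map_mul, map_prod, map_prod, ← sum_expo l.get a, ← zero_add (∑ i, _)]
  refine IsHom.mul ?_ (isHom_prod _ _ _ fun i _ => hx.isHom_qq _)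
  have := isHom_prod Finset.univ (fun _ => 0) (fun p => ev (kap (a p)))
    fun p _ => by rw [map_intCast]; exact isHom_intCast _
  simpa using this

end IsSpecialization

/-! ### Bilateral series -/

/-- A bilateral series `∑ c_m z ^ m` over `SeriesXY` is admissible if the lowest degree occurring
in `c_m` is at least `|m|`, up to a constant. Admissible series can be multiplied. -/
def Adm (c : ℤ → SeriesXY) : Prop := ∃ K : ℤ, ∀ m, Lo (|m| - K) (c m)

/-- The product of two bilateral series. -/
def conv (c g : ℤ → SeriesXY) (n : ℤ) : SeriesXY := ∑' m : ℤ, c m * g (n - m)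

/-- The bilateral series `1`. -/
def deltaSeries (n : ℤ) : SeriesXY := if n = 0 then 1 else 0

lemma finite_int_abs_le (N : ℤ) : {m : ℤ | |m| ≤ N}.Finite :=
  (Set.finite_Icc (-N) N).subset fun _ hm => abs_le.1 hm

lemma summable_conv {c g : ℤ → SeriesXY} (hc : Adm c) (hg : Adm g) (n : ℤ) :
    Summable fun m : ℤ => c m * g (n - m) := by
  obtain ⟨K, hK⟩ := hc
  obtain ⟨K', hK'⟩ := hg
  refine summable_of_lo (fun m => |m| - K - K')
    (fun m => ((hK m).mul (hK' (n - m))).mono ?_) fun N =>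
    (finite_int_abs_le (N + K + K')).subset fun m hm => ?_
  · have := abs_nonneg (n - m); omega
  · simp only [Set.mem_ofPred_eq] at hm ⊢; omega

lemma adm_conv {c g : ℤ → SeriesXY} (hc : Adm c) (hg : Adm g) : Adm (conv c g) := by
  obtain ⟨K, hK⟩ := hc
  obtain ⟨K', hK'⟩ := hg
  refine ⟨K + K', fun n => Lo.tsum fun m => ((hK m).mul (hK' (n - m))).mono ?_⟩
  have : |n| ≤ |m| + |n - m| := by simpa using abs_add_le m (n - m)
  omega

lemma conv_comm (c g : ℤ → SeriesXY) : conv c g = conv g c := by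
  ext1 n
  rw [conv, conv, ← (Equiv.subLeft n).tsum_eq]
  refine tsum_congr fun m => ?_
  simp [mul_comm]

lemma conv_assoc {a b c : ℤ → SeriesXY} (ha : Adm a) (hb : Adm b) (hc : Adm c) :
    conv (conv a b) c = conv a (conv b c) := by
  ext1 n
  have hs : Summable (Function.uncurry fun k m : ℤ => a k * b (m - k) * c (n - m)) := by
    obtain ⟨K, hK⟩ := ha
    obtain ⟨K', hK'⟩ := hb
    obtain ⟨K'', hK''⟩ := hc
    refine summable_of_lo (fun x => |x.1| + |x.2 - x.1| - K - K' - K'') (fun x =>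
      (((hK x.1).mul (hK' (x.2 - x.1))).mul (hK'' (n - x.2))).mono ?_) fun N =>
      ((finite_int_abs_le (N + K + K' + K'')).prod
        (finite_int_abs_le (N + K + K' + K''))).subset fun x hx => ?_
    · have := abs_nonneg (n - x.2); omega
    · simp only [Set.mem_ofPred_eq, Set.mem_prod] at hx ⊢
      have h1 := abs_nonneg (x.2 - x.1)
      have h2 : |x.2| ≤ |x.1| + |x.2 - x.1| := by simpa using abs_add_le x.1 (x.2 - x.1)
      omega
  have e : ∀ k m : ℤ, b (m + k - k) * c (n - (m + k)) = b m * c (n - k - m) := by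
    intro k m
    rw [add_sub_cancel_right, add_comm, sub_sub]
  have hs1 : ∀ k, Summable fun m => b (m - k) * c (n - m) := by
    intro k
    rw [← (Equiv.addRight k).summable_iff]
    simpa only [Function.comp_def, Equiv.coe_addRight, e] using summable_conv hb hc (n - k)
  calc conv (conv a b) c n = ∑' m, ∑' k, a k * b (m - k) * c (n - m) :=
        tsum_congr fun m => ((summable_conv ha hb m).tsum_mul_right _).symm
    _ = ∑' k, ∑' m, a k * b (m - k) * c (n - m) := by
        refine Summable.tsum_comm' hs (fun k => ?_) fun m => (summable_conv ha hb m).mul_right _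
        simpa only [mul_assoc] using (hs1 k).mul_left (a k)
    _ = conv a (conv b c) n := by
        refine tsum_congr fun k => ?_
        simp only [mul_assoc]
        rw [(hs1 k).tsum_mul_left, ← (Equiv.addRight k).tsum_eq]
        simp only [Equiv.coe_addRight, e]
        rfl

lemma delta_conv (c : ℤ → SeriesXY) : conv deltaSeries c = c := by
  ext1 n
  rw [conv, tsum_eq_single 0]
  · simp [deltaSeries]
  · intro m hm
    simp [deltaSeries, hm]

/-- The coefficient of `z ^ u w ^ v` in `J(z) J(w) (z - w) / (z + w)` converges if `J` is
admissible. -/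
lemma summable_kap_mul {c : ℤ → SeriesXY} (hc : Adm c) (u v : ℤ) :
    Summable fun n : ℕ => (kap n : SeriesXY) * (c (u + n) * c (v - n)) := by
  obtain ⟨K, hK⟩ := hc
  refine summable_of_lo (fun n => n - |u| - 2 * K) (fun n =>
    ((isHom_intCast (kap n)).lo.mul ((hK (u + n)).mul (hK (v - n)))).mono ?_) fun N =>
    (Set.finite_Iic (N + |u| + 2 * K).toNat).subset fun n hn => ?_
  · have h1 := abs_nonneg (v - n)
    have h2 := le_abs_self (u + n)
    have h3 := neg_abs_le u
    omega
  · simp only [Set.mem_ofPred_eq, Set.mem_Iic] at hn ⊢; omega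

/-! ### The series `Q_x(z)` as bilateral series -/

/-- `Q(-z) * Q(z) = 1` for bilateral series. -/
lemma conv_sg_qq_qq {ev : QRing →+* SeriesXY} (n : ℤ) :
    conv (fun m => sg m * ev (qq m)) (fun m => ev (qq m)) n = deltaSeries n := by
  have h := congrArg ev (sum_sg_qq 0 n n.natAbs (by omega) (by omega))
  rw [conv, tsum_eq_sum (s := Finset.Icc (-n.natAbs : ℤ) n.natAbs)]
  · simp only [zero_add, map_sum, map_mul, map_intCast] at h
    simp only [mul_assoc]
    rw [h, deltaSeries]
    split_ifs <;> simp
  · intro m hm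
    simp only [Finset.mem_Icc] at hm
    rcases lt_or_ge m 0 with h1 | h1
    · rw [qq_of_neg h1]; simp
    · rw [qq_of_neg (n := n - m) (by omega)]; simp

lemma conv_neg (c g : ℤ → SeriesXY) (n : ℤ) :
    conv (fun m => c (-m)) (fun m => g (-m)) n = conv c g (-n) := by
  rw [conv, conv, ← (Equiv.neg ℤ).tsum_eq]
  refine tsum_congr fun m => ?_
  simp only [Equiv.neg_apply]
  congr 2 <;> ring

/-- A sum over `ℤ` whose terms of negative index vanish. -/
lemma tsum_int_of_nat {t : ℤ → SeriesXY} (h : ∀ m < 0, t m = 0) : ∑' m : ℤ, t m = ∑' n : ℕ, t n := by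
  refine (Function.Injective.tsum_eq Nat.cast_injective fun m hm => ?_).symm
  exact ⟨m.toNat, Int.toNat_of_nonneg (by by_contra hn; exact hm (h m (by omega)))⟩

namespace IsSpecialization
variable {x y : ℕ → SeriesXY} {ev evY : QRing →+* SeriesXY} (hx : IsSpecialization x ev)
include hx

lemma adm_qq : Adm fun m => ev (qq m) := by
  refine ⟨0, fun m => ?_⟩
  rcases lt_or_ge m 0 with h | h
  · simp only [qq_of_neg h, map_zero]
    exact lo_zero _
  · exact (hx.isHom_qq m).lo.mono (by rw [abs_of_nonneg h]; omega)

lemma adm_sg_qq : Adm fun m => sg m * ev (qq m) := by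
  obtain ⟨K, hK⟩ := hx.adm_qq
  exact ⟨K, fun m => ((isHom_intCast (sg m)).lo.mul (hK m)).mono (by omega)⟩

lemma adm_qq_neg : Adm fun m => ev (qq (-m)) := by
  obtain ⟨K, hK⟩ := hx.adm_qq
  exact ⟨K, fun m => by simpa using hK (-m)⟩

lemma adm_sg_qq_neg : Adm fun m => sg m * ev (qq (-m)) := by
  obtain ⟨K, hK⟩ := hx.adm_sg_qq
  exact ⟨K, fun m => by simpa using hK (-m)⟩

end IsSpecialization

/-- The bilateral series `Q_X(z) * Q_Y(-1 / z)`. -/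
def bilJ (evX evY : QRing →+* SeriesXY) : ℤ → SeriesXY :=
  conv (fun m => evX (qq m)) (fun m => sg m * evY (qq (-m)))

section
variable {x y : ℕ → SeriesXY} {evX evY : QRing →+* SeriesXY}
  (hx : IsSpecialization x evX) (hy : IsSpecialization y evY)
include hx hy

lemma adm_bilJ : Adm (bilJ evX evY) := adm_conv hx.adm_qq hy.adm_sg_qq_neg

/-- The inverse of `Q_X(z) * Q_Y(-1 / z)` is `Q_Y(1 / z) * Q_X(-z)`. -/
lemma bilJ_conv_inv {g : ℤ → SeriesXY} (hg : Adm g) :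
    conv (bilJ evX evY) (conv (fun m => evY (qq (-m))) (conv (fun m => sg m * evX (qq m)) g)) =
      g := by
  have h1 : conv (fun m => (sg m : SeriesXY) * evY (qq (-m))) (fun m => evY (qq (-m))) =
      deltaSeries := by
    ext1 n
    have := conv_neg (fun m => (sg m : SeriesXY) * evY (qq m)) (fun m => evY (qq m)) n
    simp only [sg_neg] at this
    rw [this, conv_sg_qq_qq]
    simp [deltaSeries]
  have h2 : conv (fun m => evX (qq m)) (fun m => (sg m : SeriesXY) * evX (qq m)) =
      deltaSeries := by
    rw [conv_comm]; ext1 n; exact conv_sg_qq_qq n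
  have ha := adm_conv hx.adm_sg_qq hg
  rw [bilJ, conv_assoc hx.adm_qq hy.adm_sg_qq_neg (adm_conv hy.adm_qq_neg ha),
    ← conv_assoc hy.adm_sg_qq_neg hy.adm_qq_neg ha, h1, delta_conv,
    ← conv_assoc hx.adm_qq hx.adm_sg_qq hg, h2, delta_conv]

end

/-! ### The pairing of two vacuum states -/

/-- The contribution of a strict partition to `pairing`. -/
def pairTerm (evX evY : QRing →+* SeriesXY) (w w' : List ℤ) (lam : StrictPartition) : SeriesXY :=
  MvPowerSeries.C ((2 : ℚ)⁻¹ ^ lam.card) *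
    (qState evX (w ++ word lam) * qState evY (w' ++ word lam))

/-- The pairing `∑_λ 2 ^ (-ℓ(λ)) * ⟨X| φ_w |λ⟩ * ⟨Y| φ_{w'} |λ⟩`, where `|λ⟩` is created from the
vacuum by the word of `λ`, and `⟨X|`, `⟨Y|` are the states given by `evX` and `evY`. -/
def pairing (evX evY : QRing →+* SeriesXY) (w w' : List ℤ) : SeriesXY :=
  ∑' lam, pairTerm evX evY w w' lam

lemma pairing_swap (evX evY : QRing →+* SeriesXY) (w w' : List ℤ) :
    pairing evX evY w w' = pairing evY evX w' w :=
  tsum_congr fun lam => by rw [pairTerm, pairTerm, mul_comm (qState evX _)]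

lemma sum_word_nonneg (lam : StrictPartition) : 0 ≤ (word lam).sum :=
  List.sum_nonneg fun _ hx => (pos_of_mem_word hx).le

lemma finite_sum_word_le (N : ℤ) : {lam : StrictPartition | (word lam).sum ≤ N}.Finite := by
  refine ((Finset.Icc (1 : ℕ+) N.toNat.succPNat).powerset.finite_toSet).subset fun lam hlam => ?_
  simp only [Finset.coe_powerset, Set.mem_preimage, Set.mem_powerset_iff]
  intro k hk
  have h1 : (k : ℤ) ∈ word lam := pnat_cast_mem_word.2 hk
  have h2 : (k : ℤ) ≤ (word lam).sum :=
    List.single_le_sum (fun _ hx => (pos_of_mem_word hx).le) _ h1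
  simp only [Set.mem_ofPred_eq] at hlam
  simp only [Finset.mem_coe, Finset.mem_Icc, one_le, true_and]
  rw [← PNat.coe_le_coe, Nat.succPNat_coe]
  omega

section
variable {x y : ℕ → SeriesXY} {evX evY : QRing →+* SeriesXY}
  (hx : IsSpecialization x evX) (hy : IsSpecialization y evY)
include hx hy

/-- A term of the pairing vanishes to high order, or vanishes altogether because one of its two
factors has negative degree. -/
lemma lo_pairTerm (w w' : List ℤ) (lam : StrictPartition) (n : ℤ)
    (h : 0 ≤ w.sum + (word lam).sum → 0 ≤ w'.sum + (word lam).sum →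
      n ≤ w.sum + w'.sum + 2 * (word lam).sum) : Lo n (pairTerm evX evY w w' lam) := by
  have h1 := hx.isHom_qState (w ++ word lam)
  have h2 := hy.isHom_qState (w' ++ word lam)
  rw [List.sum_append] at h1 h2
  unfold pairTerm
  rcases lt_or_ge (w.sum + (word lam).sum) 0 with h3 | h3
  · rw [h1.eq_zero h3]; simpa using lo_zero n
  rcases lt_or_ge (w'.sum + (word lam).sum) 0 with h4 | h4
  · rw [h2.eq_zero h4]; simpa using lo_zero n
  · have := h h3 h4
    exact ((isHom_C _).lo.mul (h1.lo.mul h2.lo)).mono (by omega)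

lemma summable_pairTerm (w w' : List ℤ) : Summable (pairTerm evX evY w w') := by
  refine summable_of_lo (fun lam => w.sum + w'.sum + (word lam).sum)
    (fun lam => lo_pairTerm hx hy w w' lam _ fun _ _ => ?_) fun N =>
    (finite_sum_word_le (N - w.sum - w'.sum)).subset fun lam hlam => ?_
  · have := sum_word_nonneg lam; omega
  · simp only [Set.mem_ofPred_eq] at hlam ⊢; omega

lemma adm_pairing (w : List ℤ) : Adm fun m => pairing evX evY (m :: w) [] := by
  refine ⟨|w.sum|, fun m => Lo.tsum fun lam => lo_pairTerm hx hy _ _ lam _ fun h _ => ?_⟩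
  have h1 := sum_word_nonneg lam
  have h2 := neg_abs_le w.sum
  have h3 := le_abs_self w.sum
  rw [List.sum_cons] at h ⊢
  rw [List.sum_nil]
  rcases abs_cases m with h4 | h4 <;> omega

/-- The state `⟨X|` is annihilated by the modes of `Q_X(-z) φ(z)` at positive powers of `z`, and
fixed by its constant term. -/
lemma tsum_qq_pairing (n : ℕ) (w w' : List ℤ) :
    ∑' j : ℕ, (-1) ^ j * evX (qq j) * pairing evX evY ((n - j : ℤ) :: w) w' =
      if n = 0 then pairing evX evY w w' else 0 := by
  have hsum : ∀ j : ℕ, Summable fun lam =>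
      (-1) ^ j * evX (qq j) * pairTerm evX evY ((n - j : ℤ) :: w) w' lam :=
    fun j => (summable_pairTerm hx hy _ _).mul_left _
  have hinner : ∀ lam, HasSum (fun j : ℕ =>
      (-1) ^ j * evX (qq j) * pairTerm evX evY ((n - j : ℤ) :: w) w' lam)
      (if n = 0 then pairTerm evX evY w w' lam else 0) := by
    intro lam
    obtain ⟨N₀, hN₀⟩ := sum_qq_qState evX n (w ++ word lam)
    have hN : ∀ N, N₀ ≤ N → ∑ j ∈ Finset.range N,
        (-1) ^ j * evX (qq j) * pairTerm evX evY ((n - j : ℤ) :: w) w' lam =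
        if n = 0 then pairTerm evX evY w w' lam else 0 := by
      intro N hN
      have h1 : ∀ j ∈ Finset.range N,
          (-1) ^ j * evX (qq j) * pairTerm evX evY ((n - j : ℤ) :: w) w' lam =
          MvPowerSeries.C ((2 : ℚ)⁻¹ ^ lam.card) * qState evY (w' ++ word lam) *
            ((-1) ^ j * evX (qq j) * qState evX ((n - j : ℤ) :: (w ++ word lam))) := by
        intro j _
        rw [pairTerm, List.cons_append]; ring
      rw [Finset.sum_congr rfl h1, ← Finset.mul_sum, hN₀ N hN]
      split_ifs
      · rw [pairTerm]; ring
      · ring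
    have h0 : ∀ j, N₀ ≤ j →
        (-1) ^ j * evX (qq j) * pairTerm evX evY ((n - j : ℤ) :: w) w' lam = 0 := by
      intro j hj
      have h1 := hN j hj
      have h2 := hN (j + 1) (by omega)
      rw [Finset.sum_range_succ, h1] at h2
      simpa using h2
    rw [← hN N₀ le_rfl]
    exact hasSum_sum_of_ne_finset_zero fun j hj => h0 j (by simpa using hj)
  -- A nonzero term of index `(j, λ)` has degree at least `j + |λ|` up to a constant, because both
  -- factors of the pairing have nonnegative degree.
  have hdouble : Summable (Function.uncurry fun (j : ℕ) lam =>
      (-1) ^ j * evX (qq j) * pairTerm evX evY ((n - j : ℤ) :: w) w' lam) := by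
    refine summable_of_lo (fun z => z.1 + (w'.sum + (word z.2).sum)) (fun z => ?_) fun N =>
      ((Set.finite_Iic (N + |w'.sum|).toNat).prod
        (finite_sum_word_le (N + |w'.sum|))).subset fun z hz => ?_
    · have h1 : Lo z.1 ((-1) ^ z.1 * evX (qq z.1)) := by
        have := ((hx.isHom_qq z.1).sg_mul z.1).lo
        simpa using this
      refine h1.mul (lo_pairTerm hx hy _ _ _ _ fun h2 _ => ?_)
      omega
    · simp only [Set.mem_ofPred_eq, Set.mem_prod, Set.mem_Iic] at hz ⊢
      have := neg_abs_le w'.sum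
      have := sum_word_nonneg z.2
      omega
  calc _ = ∑' j : ℕ, ∑' lam, (-1) ^ j * evX (qq j) *
        pairTerm evX evY ((n - j : ℤ) :: w) w' lam :=
        tsum_congr fun j => ((summable_pairTerm hx hy _ _).tsum_mul_left _).symm
    _ = ∑' lam, ∑' j : ℕ, (-1) ^ j * evX (qq j) *
        pairTerm evX evY ((n - j : ℤ) :: w) w' lam :=
        (Summable.tsum_comm' hdouble hsum fun lam => (hinner lam).summable).symm
    _ = ∑' lam, if n = 0 then pairTerm evX evY w w' lam else 0 :=
        tsum_congr fun lam => (hinner lam).tsum_eq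
    _ = _ := by
        split_ifs
        · rfl
        · simp

/-- Moving the first letter to the end of the word. -/
lemma pairing_contract (u : ℤ) (w : List ℤ) :
    pairing evX evY (u :: w) [] = ∑ i ∈ Finset.range w.length,
        (-1) ^ i * ((if u + w.getD i 0 = 0 then 2 * (sg u : SeriesXY) else 0) *
          pairing evX evY (w.eraseIdx i) []) +
      (-1) ^ w.length * pairing evX evY (w ++ [u]) [] := by
  have h : ∀ lam, pairTerm evX evY (u :: w) [] lam = ∑ i ∈ Finset.range w.length,
        (-1) ^ i * (if u + w.getD i 0 = 0 then 2 * (sg u : SeriesXY) else 0) *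
          pairTerm evX evY (w.eraseIdx i) [] lam +
      (-1) ^ w.length * pairTerm evX evY (w ++ [u]) [] lam := by
    intro lam
    have := (isVacuumState_qState evX).contract u w [] (word lam)
    simp only [List.nil_append] at this
    simp only [pairTerm, List.nil_append, List.cons_append, List.append_assoc]
    rw [this, add_mul, mul_add, Finset.sum_mul, Finset.mul_sum]
    congr 1
    · exact Finset.sum_congr rfl fun i _ => by ring
    · ring
  have hs := fun w => summable_pairTerm hx hy w []
  rw [pairing, tsum_congr h, Summable.tsum_add (summable_sum fun i _ => (hs _).mul_left _)
    ((hs _).mul_left _), Summable.tsum_finsetSum fun i _ => (hs _).mul_left _,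
    (hs _).tsum_mul_left]
  congr 1
  refine Finset.sum_congr rfl fun i _ => ?_
  rw [(hs _).tsum_mul_left, mul_assoc]
  rfl

omit hx hy in
/-- Adding or removing the part `k`. -/
lemma toggle_involutive (k : ℕ+) :
    Function.Involutive fun lam : StrictPartition => if k ∈ lam then lam.erase k else insert k lam := by
  intro lam
  by_cases h : k ∈ lam
  · simp [h]
  · simp [h]

omit hx hy in
lemma C_inv_two_mul_two : MvPowerSeries.C (2 : ℚ)⁻¹ * (2 : SeriesXY) = 1 := by
  rw [← map_ofNat MvPowerSeries.C 2, ← map_mul]; norm_num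

/-- The creation operator `φ_k` for `⟨X|` is adjoint to the annihilation operator
`(-1) ^ k φ_{-k}` for `⟨Y|`. -/
lemma pairing_adjoint_pos (w w' : List ℤ) (k : ℕ+) :
    pairing evX evY (w ++ [(k : ℤ)]) w' =
      sg (k : ℤ) * pairing evX evY w (w' ++ [-(k : ℤ)]) := by
  have hX := isVacuumState_qState evX
  have hY := isVacuumState_qState evY
  -- The terms of `λ` on the left and of `λ` with `k` toggled on the right agree: both vanish if
  -- `k ∈ λ`, and otherwise `φ_k` creates the part `k` on the left and `φ_{-k}` removes it on the right.
  have h : ∀ lam, pairTerm evX evY (w ++ [(k : ℤ)]) w' lam =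
      sg (k : ℤ) * pairTerm evX evY w (w' ++ [-(k : ℤ)])
        (if k ∈ lam then lam.erase k else insert k lam) := by
    intro lam
    simp only [pairTerm, List.append_assoc, List.cons_append, List.nil_append]
    split_ifs with hk
    · rw [hX.pos_word hk, hY.neg_word (Finset.notMem_erase k lam)]
      ring
    · obtain ⟨ε, hε, h⟩ := exists_sign_insert SeriesXY hk
      have h1 := h _ hY (w' ++ [-(k : ℤ)])
      simp only [List.append_assoc, List.cons_append, List.nil_append] at h1
      have hε' : (ε : SeriesXY) * ε = 1 := by rw [← Int.cast_mul, hε, Int.cast_one]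
      have hsg : (sg (k : ℤ) : SeriesXY) * sg (k : ℤ) = 1 := by
        rw [← Int.cast_mul, sg_mul_self, Int.cast_one]
      rw [h1, h _ hX w, hY.neg_pos_word hk, Finset.card_insert_of_notMem hk, pow_succ, map_mul]
      have e := C_inv_two_mul_two
      linear_combination (-MvPowerSeries.C ((2 : ℚ)⁻¹ ^ lam.card) *
        qState evX (w ++ (k : ℤ) :: word lam) * qState evY (w' ++ word lam)) *
        (ε * ε * (sg (k : ℤ) * sg (k : ℤ)) * e + ε * ε * hsg + hε')
  have hs : ∀ t : StrictPartition → SeriesXY,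
      ∑' lam, t lam = ∑' lam, t (if k ∈ lam then lam.erase k else insert k lam) :=
    fun t => ((toggle_involutive k).toPerm.tsum_eq t).symm
  rw [pairing, tsum_congr h, pairing, ← hs (fun lam => sg (k : ℤ) *
    pairTerm evX evY w (w' ++ [-(k : ℤ)]) lam), (summable_pairTerm hx hy _ _).tsum_mul_left]

omit hx hy in
/-- `φ_0` acts as the parity operator. -/
lemma IsVacuumState.zero_append {R : Type*} [CommRing R] {f : List ℤ → R} (hf : IsVacuumState f)
    (p s : List ℤ) (hs : ∀ z ∈ s, 0 < z) : f (p ++ 0 :: s) = (-1) ^ s.length * f (p ++ s) := by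
  induction s generalizing p with
  | nil => simpa using hf.last_zero p
  | cons b s ih =>
    have h1 := hf.anticomm p s 0 b
    have h2 := ih (p ++ [b]) fun z hz => hs z (List.mem_cons_of_mem _ hz)
    rw [if_neg (by have := hs b (by simp); omega)] at h1
    simp only [List.append_assoc, List.cons_append, List.nil_append] at h2
    rw [List.length_cons, pow_succ]
    linear_combination h1 - h2

/-- The adjoint of `φ_m` is `(-1) ^ m φ_{-m}`. -/
lemma pairing_adjoint (w : List ℤ) (m : ℤ) :
    pairing evX evY (w ++ [m]) [] = sg m * pairing evX evY w [-m] := by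
  rcases lt_trichotomy m 0 with h | rfl | h
  · obtain ⟨k, hk⟩ : ∃ k : ℕ+, -m = k := ⟨⟨(-m).toNat, by omega⟩, by simp; omega⟩
    have h1 := pairing_adjoint_pos hy hx [] w k
    have hsg : (sg m : SeriesXY) * sg m = 1 := by rw [← Int.cast_mul, sg_mul_self, Int.cast_one]
    rw [← hk, neg_neg, pairing_swap, pairing_swap evY evX, sg_neg, List.nil_append] at h1
    rw [h1, ← mul_assoc, hsg, one_mul]
  · rw [sg_zero, Int.cast_one, one_mul, neg_zero]
    refine tsum_congr fun lam => ?_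
    have h1 := (isVacuumState_qState evX).zero_append w _ fun z hz => pos_of_mem_word (lam := lam) hz
    have h2 := (isVacuumState_qState evY).zero_append [] _
      fun z hz => pos_of_mem_word (lam := lam) hz
    simp only [pairTerm, List.append_assoc, List.cons_append, List.nil_append] at h1 h2 ⊢
    rw [h1, h2]; ring
  · obtain ⟨k, rfl⟩ : ∃ k : ℕ+, m = k := ⟨⟨m.toNat, by omega⟩, by simp; omega⟩
    exact pairing_adjoint_pos hx hy w [] k

/-! ### Wick's theorem -/

/-- The coefficient of `z ^ u w ^ v` in `J(z) J(w) (z - w) / (z + w)`, where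
`J(z) = Q_X(z) * Q_Y(-1 / z)`. -/
def twoPoint (evX evY : QRing →+* SeriesXY) (u v : ℤ) : SeriesXY :=
  ∑' n : ℕ, (kap n : SeriesXY) * (bilJ evX evY (u + n) * bilJ evX evY (v - n))

/-- The modes of `Q_X(-z) φ(z)` at nonnegative powers of `z`. -/
lemma conv_sg_qq_pairing (w : List ℤ) (n : ℕ) :
    conv (fun m => sg m * evX (qq m)) (fun m => pairing evX evY (m :: w) []) n =
      if n = 0 then pairing evX evY w [] else 0 := by
  rw [conv, tsum_int_of_nat]
  · rw [← tsum_qq_pairing hx hy n w []]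
    simp
  · intro m hm
    rw [qq_of_neg hm]; simp

/-- The modes of `Q_Y(1 / z) φ(z)` at nonpositive powers of `z`: moving `φ(z)` through the word `w`
gives the contractions and the modes of `Q_Y(1 / z) φ(z)` at `|Y⟩`, which vanish except for the constant
term. -/
lemma conv_qq_neg_pairing (w : List ℤ) (hw : Odd w.length) (n : ℕ) :
    conv (fun m => evY (qq (-m))) (fun m => pairing evX evY (m :: w) []) (-n) =
      ∑ i ∈ Finset.range w.length, (-1) ^ i * (2 * sg (w.getD i 0) * evY (qq (n - w.getD i 0)) *
          pairing evX evY (w.eraseIdx i) []) - if n = 0 then pairing evX evY w [] else 0 := by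
  have hterm : ∀ j : ℤ, evY (qq j) * pairing evX evY ((-n + j : ℤ) :: w) [] =
      ∑ i ∈ Finset.range w.length, (-1) ^ i *
        (if j = n - w.getD i 0 then 2 * sg (w.getD i 0) * evY (qq j) *
          pairing evX evY (w.eraseIdx i) [] else 0) -
        (sg n : SeriesXY) * (sg j * evY (qq j) * pairing evX evY w [n - j]) := by
    intro j
    rw [pairing_contract hx hy, hw.neg_one_pow, pairing_adjoint hx hy, mul_add, Finset.mul_sum,
      sub_eq_add_neg]
    congr 1
    · refine Finset.sum_congr rfl fun i _ => ?_
      by_cases h : j = n - w.getD i 0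
      · rw [if_pos h, if_pos (by omega), show -(n : ℤ) + j = - w.getD i 0 by omega, sg_neg]
        ring
      · rw [if_neg h, if_neg (by omega)]; ring
    · rw [sg_add, sg_neg, show -(-(n : ℤ) + j) = n - j by ring]
      push_cast; ring
  have hA : HasSum (fun j : ℤ => ∑ i ∈ Finset.range w.length, (-1) ^ i *
        (if j = n - w.getD i 0 then 2 * sg (w.getD i 0) * evY (qq j) *
          pairing evX evY (w.eraseIdx i) [] else 0))
      (∑ i ∈ Finset.range w.length, (-1) ^ i * (2 * sg (w.getD i 0) * evY (qq (n - w.getD i 0)) *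
          pairing evX evY (w.eraseIdx i) [])) := by
    refine hasSum_sum fun i _ => HasSum.mul_left _ ?_
    have := hasSum_single (f := fun j : ℤ => if j = n - w.getD i 0 then
      2 * (sg (w.getD i 0) : SeriesXY) * evY (qq j) * pairing evX evY (w.eraseIdx i) [] else 0)
      (n - w.getD i 0) fun j hj => if_neg hj
    simpa using this
  have hL : Summable fun j : ℤ => evY (qq j) * pairing evX evY ((-n + j : ℤ) :: w) [] := by
    have := summable_conv hy.adm_qq_neg (adm_pairing hx hy w) (-n)
    rw [← (Equiv.neg ℤ).summable_iff] at this
    simpa [Function.comp_def] using this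
  -- The terms in which `φ(z)` has reached `|Y⟩` are summable, being a difference of summable families.
  have hB : Summable fun j : ℤ =>
      (sg n : SeriesXY) * (sg j * evY (qq j) * pairing evX evY w [n - j]) := by
    refine (hA.summable.sub hL).congr fun j => ?_
    rw [hterm]; ring
  have hBsum : ∑' j : ℤ, (sg n : SeriesXY) * (sg j * evY (qq j) * pairing evX evY w [n - j]) =
      if n = 0 then pairing evX evY w [] else 0 := by
    have hB' : Summable fun j : ℤ => (sg j : SeriesXY) * evY (qq j) * pairing evX evY w [n - j] := by
      refine (hB.mul_left (sg n : SeriesXY)).congr fun j => ?_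
      rw [← mul_assoc, ← Int.cast_mul, sg_mul_self, Int.cast_one, one_mul]
    rw [hB'.tsum_mul_left, tsum_int_of_nat]
    · have := tsum_qq_pairing hy hx n [] w
      simp only [pairing_swap evX evY w, sg_natCast, Int.cast_pow, Int.cast_neg, Int.cast_one]
      rw [this]
      split_ifs with h
      · simp [h]
      · simp
    · intro m hm
      rw [qq_of_neg hm]; simp
  rw [conv, ← (Equiv.neg ℤ).tsum_eq, ← hBsum, ← hA.tsum_eq, ← hA.summable.tsum_sub hB]
  refine tsum_congr fun j => ?_
  rw [← hterm]
  simp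

/-- The product of the generating series `∑ ⟨φ_m φ_w, ∅⟩ z ^ m` with the inverse of `J(z)`. -/
def dressed (evX evY : QRing →+* SeriesXY) (w : List ℤ) : ℤ → SeriesXY :=
  conv (fun m => evY (qq (-m))) (conv (fun m => sg m * evX (qq m))
    (fun m => pairing evX evY (m :: w) []))

lemma dressed_of_pos (w : List ℤ) {n : ℤ} (hn : 0 < n) : dressed evX evY w n = 0 := by
  have h : ∀ m, evY (qq (-m)) * conv (fun m => sg m * evX (qq m))
      (fun m => pairing evX evY (m :: w) []) (n - m) = 0 := by
    intro m
    rcases lt_or_ge 0 m with h | h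
    · rw [qq_of_neg (by omega)]; simp
    · obtain ⟨k, hk⟩ := Int.eq_ofNat_of_zero_le (show 0 ≤ n - m by omega)
      rw [hk, conv_sg_qq_pairing hx hy, if_neg (by omega), mul_zero]
  rw [dressed, conv, tsum_congr h, tsum_zero]

lemma dressed_zero (w : List ℤ) : dressed evX evY w 0 = pairing evX evY w [] := by
  rw [dressed, conv, tsum_eq_single 0]
  · have := conv_sg_qq_pairing hx hy w 0
    simp only [Nat.cast_zero] at this
    simp [this]
  · intro m hm
    rcases lt_or_gt_of_ne hm with h | h
    · obtain ⟨k, hk⟩ := Int.eq_ofNat_of_zero_le (show 0 ≤ 0 - m by omega)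
      rw [hk, conv_sg_qq_pairing hx hy, if_neg (by omega), mul_zero]
    · rw [qq_of_neg (by omega)]; simp

lemma dressed_neg (w : List ℤ) (hw : Odd w.length) (n : ℕ) :
    dressed evX evY w (-n) = ∑ i ∈ Finset.range w.length, (-1) ^ i *
        (2 * (-1) ^ n * bilJ evX evY (w.getD i 0 - n) * pairing evX evY (w.eraseIdx i) []) -
      if n = 0 then pairing evX evY w [] else 0 := by
  have hg := adm_pairing hx hy w
  have hswap : dressed evX evY w = conv (fun m => sg m * evX (qq m)) (conv (fun m => evY (qq (-m)))
      (fun m => pairing evX evY (m :: w) [])) := by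
    rw [dressed, ← conv_assoc hy.adm_qq_neg hx.adm_sg_qq hg, conv_comm (fun m => evY (qq (-m))),
      conv_assoc hx.adm_sg_qq hy.adm_qq_neg hg]
  have hterm : ∀ m : ℤ, (sg m * evX (qq m)) * conv (fun m => evY (qq (-m)))
      (fun m => pairing evX evY (m :: w) []) (-n - m) =
      ∑ i ∈ Finset.range w.length, (-1) ^ i * (2 * (-1) ^ n *
        pairing evX evY (w.eraseIdx i) [] * (evX (qq m) *
          (sg (w.getD i 0 - n - m) * evY (qq (-(w.getD i 0 - n - m)))))) -
      if m = 0 then (if n = 0 then pairing evX evY w [] else 0) else 0 := by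
    intro m
    rcases lt_or_ge m 0 with h | h
    · rw [qq_of_neg h, if_neg h.ne]; simp
    · obtain ⟨k, rfl⟩ := Int.eq_ofNat_of_zero_le h
      rw [show -(n : ℤ) - k = -(n + k : ℕ) by push_cast; ring, conv_qq_neg_pairing hx hy w hw,
        mul_sub, Finset.mul_sum]
      congr 1
      · refine Finset.sum_congr rfl fun i _ => ?_
        rw [sg_sub, sg_sub, show -(w.getD i 0 - n - k) = (n + k : ℕ) - w.getD i 0 by push_cast; ring]
        simp only [sg_natCast]
        have h1 : ((-1 : SeriesXY) ^ n) * (-1) ^ n = 1 := by rw [← mul_pow]; simp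
        push_cast
        linear_combination (-(-1) ^ k * evX (qq k) * (-1) ^ i * 2 * sg (w.getD i 0) *
          evY (qq (n + k - w.getD i 0)) * pairing evX evY (w.eraseIdx i) []) * h1
      · by_cases hk : k = 0
        · subst hk; by_cases hn : n = 0
          · simp [hn]
          · simp [hn]
        · rw [if_neg (by omega), if_neg (by omega), mul_zero]
  have hJ : ∀ i, HasSum (fun m : ℤ => evX (qq m) *
      (sg (w.getD i 0 - n - m) * evY (qq (-(w.getD i 0 - n - m))))) (bilJ evX evY (w.getD i 0 - n)) :=
    fun i => (summable_conv hx.adm_qq hy.adm_sg_qq_neg (w.getD i 0 - n)).hasSum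
  have h1 : HasSum (fun m : ℤ => if m = 0 then (if n = 0 then pairing evX evY w [] else 0) else 0)
      (if n = 0 then pairing evX evY w [] else 0) := by
    have := hasSum_single (f := fun m : ℤ => if m = 0 then
      (if n = 0 then pairing evX evY w [] else 0) else 0) 0 fun j hj => if_neg hj
    simpa using this
  rw [hswap, conv, tsum_congr hterm]
  have h2 := (hasSum_sum (s := Finset.range w.length) fun i _ =>
    ((hJ i).mul_left (2 * (-1) ^ n * pairing evX evY (w.eraseIdx i) [])).mul_left ((-1) ^ i)).sub h1
  rw [h2.tsum_eq]
  congr 1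
  exact Finset.sum_congr rfl fun i _ => by ring

/-- The two evaluations of the constant term show that it equals half of its contractions, so that
the formula for the negative modes holds for it too, with `kap 0 = 1` instead of `2`. -/
lemma dressed_neg_eq_kap (w : List ℤ) (hw : Odd w.length) (n : ℕ) :
    dressed evX evY w (-n) = ∑ i ∈ Finset.range w.length, (-1) ^ i *
        (kap n * bilJ evX evY (w.getD i 0 - n) * pairing evX evY (w.eraseIdx i) []) := by
  have h := dressed_neg hx hy w hw n
  rcases n with _ | n
  · have h0 := dressed_zero hx hy w
    simp only [Nat.cast_zero, neg_zero, if_pos, pow_zero, mul_one, sub_zero, kap_zero,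
      Int.cast_one, one_mul] at h ⊢
    have h3 : ∑ i ∈ Finset.range w.length, (-1) ^ i * (2 * bilJ evX evY (w.getD i 0) *
        pairing evX evY (w.eraseIdx i) []) = 2 * ∑ i ∈ Finset.range w.length, (-1) ^ i *
        (bilJ evX evY (w.getD i 0) * pairing evX evY (w.eraseIdx i) []) := by
      rw [Finset.mul_sum]
      exact Finset.sum_congr rfl fun i _ => by ring
    rw [h3] at h
    rw [← h0] at h
    linear_combination (MvPowerSeries.C (2 : ℚ)⁻¹) * h + (∑ i ∈ Finset.range w.length, (-1) ^ i *
        (bilJ evX evY (w.getD i 0) * pairing evX evY (w.eraseIdx i) []) -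
        dressed evX evY w 0) * C_inv_two_mul_two
  · rw [h, if_neg (Nat.succ_ne_zero n), sub_zero]
    simp [kap]

/-- Wick's theorem: the normalized pairing `w ↦ ⟨X| φ_w |Y⟩` expands along the first letter. -/
theorem pairing_wick (u : ℤ) (w : List ℤ) (hw : Odd w.length) :
    pairing evX evY (u :: w) [] = ∑ i ∈ Finset.range w.length,
      (-1) ^ i * twoPoint evX evY u (w.getD i 0) * pairing evX evY (w.eraseIdx i) [] := by
  have h := congrFun (bilJ_conv_inv hx hy (adm_pairing hx hy w)) u
  change conv (bilJ evX evY) (dressed evX evY w) u = _ at h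
  rw [← h, conv_comm, conv, ← (Equiv.neg ℤ).tsum_eq, tsum_int_of_nat]
  · have hJ := adm_bilJ hx hy
    have hterm : ∀ n : ℕ, dressed evX evY w (Equiv.neg ℤ n) * bilJ evX evY (u - Equiv.neg ℤ n) =
        ∑ i ∈ Finset.range w.length, (-1) ^ i * pairing evX evY (w.eraseIdx i) [] *
          (kap n * (bilJ evX evY (u + n) * bilJ evX evY (w.getD i 0 - n))) := by
      intro n
      rw [Equiv.neg_apply, dressed_neg_eq_kap hx hy w hw, sub_neg_eq_add, Finset.sum_mul]
      exact Finset.sum_congr rfl fun i _ => by ring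
    rw [tsum_congr hterm]
    have := hasSum_sum (s := Finset.range w.length) fun i _ =>
      ((summable_kap_mul hJ u (w.getD i 0)).hasSum.mul_left
        ((-1) ^ i * pairing evX evY (w.eraseIdx i) []))
    rw [this.tsum_eq]
    exact Finset.sum_congr rfl fun i _ => by rw [twoPoint]; ring
  · intro m hm
    rw [Equiv.neg_apply, dressed_of_pos hx hy w (by omega), zero_mul]

end

/-! ### Pfaffians -/

lemma eraseIdx_ofFn {α : Type*} {n : ℕ} (t : Fin (n + 1) → α) (j : Fin (n + 1)) :
    (List.ofFn t).eraseIdx j = List.ofFn fun i => t (j.succAbove i) := by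
  apply List.ext_getElem
  · simp [List.length_eraseIdx, Fin.is_le j]
  · intro i h1 h2
    rw [List.getElem_eraseIdx]
    simp only [List.getElem_ofFn]
    simp only [List.length_ofFn] at h2
    split_ifs with h
    · congr 1
      rw [Fin.succAbove_of_castSucc_lt _ _ (by simpa [Fin.lt_def] using h)]
      rfl
    · congr 1
      rw [Fin.succAbove_of_le_castSucc _ _ (by simpa [Fin.le_def] using h)]
      rfl

/-- Iterating Wick's theorem expresses the pairing as a pfaffian. The entries of the matrix may be
rescaled by `c * d_i * d_j`. -/
lemma pairing_ofFn {x y : ℕ → SeriesXY} {evX evY : QRing →+* SeriesXY}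
    (hx : IsSpecialization x evX) (hy : IsSpecialization y evY) (c : SeriesXY) (d : ℤ → SeriesXY)
    (n : ℕ) (s : Fin (2 * n) → ℤ) (A : Matrix (Fin (2 * n)) (Fin (2 * n)) SeriesXY)
    (hA : ∀ i j, i < j → A i j = c * (d (s i) * d (s j)) * twoPoint evX evY (s i) (s j)) :
    c ^ n * (∏ i, d (s i)) * pairing evX evY (List.ofFn s) [] =
      pairing evX evY [] [] * pfaffian n A := by
  induction n with
  | zero => simp [pfaffian]
  | succ n ih =>
    have hs : List.ofFn s = s 0 :: List.ofFn fun i : Fin (2 * n + 1) => s i.succ :=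
      List.ofFn_succ (n := 2 * n + 1)
    rw [hs, pairing_wick hx hy _ _ (by simp), List.length_ofFn, Finset.sum_range, Finset.mul_sum,
      pfaffian, Finset.mul_sum]
    refine Finset.sum_congr rfl fun j _ => ?_
    rw [eraseIdx_ofFn]
    have h1 := ih (fun i => s (j.succAbove i).succ)
      (A.submatrix (fun i => (j.succAbove i).succ) (fun i => (j.succAbove i).succ))
      fun a b hab => hA _ _ (Fin.succ_lt_succ_iff.2
        (Fin.strictMono_succAbove j hab))
    have h2 : ∏ i : Fin (2 * n + 2), d (s i) =
        d (s 0) * (d (s j.succ) * ∏ i, d (s (j.succAbove i).succ)) := by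
      rw [Fin.prod_univ_succ (n := 2 * n + 1), Fin.prod_univ_succAbove _ j]
    have h3 : (List.ofFn fun i : Fin (2 * n + 1) => s i.succ).getD j 0 = s j.succ := by
      rw [List.getD_eq_getElem _ _ (by simp [Fin.is_le j]), List.getElem_ofFn]
    rw [h3, hA 0 j.succ (Fin.succ_pos j)]
    change c ^ (n + 1) * (∏ i : Fin (2 * n + 2), d (s i)) * _ = _
    rw [h2]
    linear_combination (c * d (s 0) * d (s j.succ) * (-1) ^ (j : ℕ) *
      twoPoint evX evY (s 0) (s j.succ)) * h1

lemma nested_eq (l : List ℤ) : nested l = l ++ (l.map fun k => -k).reverse := by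
  induction l with
  | nil => rfl
  | cons k l ih => simp [nested, ih]

lemma ofFn_signedSeq {N : ℕ} (k : Fin N → ℕ+) :
    List.ofFn (signedSeq k) = nested ((List.ofFn k).map fun m : ℕ+ => (m : ℤ)) := by
  rw [nested_eq]
  apply List.ext_getElem
  · simp; omega
  · intro i h1 h2
    simp only [List.length_ofFn] at h1
    rw [List.getElem_ofFn, signedSeq]
    by_cases hi : i < N
    · rw [dif_pos hi, List.getElem_append_left (by simpa using hi)]
      simp
    · rw [dif_neg hi, List.getElem_append_right (by simpa using hi)]
      simp only [List.getElem_reverse, List.getElem_map, List.getElem_ofFn, List.length_map,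
        List.length_ofFn]
      congr 4
      simp only [Fin.mk.injEq]
      omega

/-- A sign with `eps u v = halfSign u * halfSign v` whenever `u > 0` or `v < 0`. -/
def halfSign (u : ℤ) : SeriesXY := if 0 < u then 1 else (sg u : SeriesXY)

lemma C_neg_one_zpow (u : ℤ) : MvPowerSeries.C ((-1 : ℚ) ^ u) = (sg u : SeriesXY) := by
  rw [← Int.cast_negOnePow ℚ u, map_intCast]; rfl

lemma C_eps {u v : ℤ} (h : 0 < u ∨ v < 0) :
    MvPowerSeries.C (eps u v) = halfSign u * halfSign v := by
  unfold eps halfSign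
  split_ifs with h1 h2 h2
  · simp
  · rw [C_neg_one_zpow, one_mul]
  · omega
  · rw [C_neg_one_zpow, sg_add]; push_cast; rfl

lemma prod_halfSign_nested (l : List ℕ+) :
    ((nested (l.map fun m : ℕ+ => (m : ℤ))).map halfSign).prod *
      (((l.map fun m : ℕ+ => 2 * sg (m : ℤ)).prod : ℤ) : SeriesXY) = 2 ^ l.length := by
  induction l with
  | nil => simp [nested]
  | cons k l ih =>
    have hk : (0 : ℤ) < k := by exact_mod_cast k.pos
    have hsg : (sg (k : ℤ) : SeriesXY) * sg (k : ℤ) = 1 := by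
      rw [← Int.cast_mul, sg_mul_self, Int.cast_one]
    have h1 : halfSign (k : ℤ) = 1 := if_pos hk
    have h2 : halfSign (-(k : ℤ)) = sg (k : ℤ) := by
      rw [halfSign, if_neg (by omega), sg_neg]
    simp only [List.map_cons, nested, List.prod_cons, List.map_append, List.prod_append,
      List.map_nil, List.prod_nil, h1, h2, List.length_cons, pow_succ, ← ih]
    rw [Int.cast_mul, Int.cast_mul, Int.cast_ofNat]
    linear_combination (2 * ((nested (l.map fun m : ℕ+ => (m : ℤ))).map halfSign).prod *
      (((l.map fun m : ℕ+ => 2 * sg (m : ℤ)).prod : ℤ) : SeriesXY)) * hsg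

/-! ### The shifted Schur measure -/

section
variable {evX evY : QRing →+* SeriesXY}
  (hx : IsSpecialization varX evX) (hy : IsSpecialization varY evY)
include hx hy

lemma weight_eq (lam : StrictPartition) : weight lam = pairTerm evX evY [] [] lam := by
  rw [weight, schurP, pairTerm, hx.schurQ_eq, hy.schurQ_eq, List.nil_append]
  ring

lemma normConst_eq : normConst = pairing evX evY [] [] := tsum_congr (weight_eq hx hy)

lemma summable_weight : Summable weight :=
  (summable_pairTerm hx hy [] []).congr fun lam => (weight_eq hx hy lam).symm

lemma constantCoeff_normConst : MvPowerSeries.constantCoeff normConst = 1 := by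
  have hs := (MvPowerSeries.WithPiTopology.hasSum_iff_hasSum_coeff.1
    (summable_weight hx hy).hasSum) 0
  rw [← MvPowerSeries.coeff_zero_eq_constantCoeff_apply, normConst, ← hs.tsum_eq,
    tsum_eq_single ∅]
  · have hw : word ∅ = [] := List.length_eq_zero_iff.1 (by
      rw [word, List.length_ofFn, Finset.card_empty])
    rw [weight_eq hx hy]
    simp [pairTerm, hw, qState]
  · intro lam hlam
    obtain ⟨k, hk⟩ := Finset.nonempty_iff_ne_empty.2 hlam
    have h1 : (k : ℤ) ≤ (word lam).sum :=
      List.single_le_sum (fun _ hx => (pos_of_mem_word hx).le) _ (pnat_cast_mem_word.2 hk)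
    have h2 : (0 : ℤ) < k := by exact_mod_cast k.pos
    rw [weight_eq hx hy]
    refine lo_pairTerm hx hy [] [] lam 1 (fun _ _ => ?_) 0 (by simp)
    simp only [List.sum_nil]; omega

lemma isUnit_normConst : IsUnit normConst := by
  rw [MvPowerSeries.isUnit_iff_constantCoeff, constantCoeff_normConst hx hy]
  exact isUnit_one

lemma JTerm_eq (u : ℤ) (n : ℕ) : JTerm u n =
    evX (qq (u + n)) * (sg (u - (u + n)) * evY (qq (-(u - (u + n))))) := by
  rw [hx.ev_qq, show -(u - (u + (n : ℤ))) = n by ring, hy.ev_qq, JTerm, show u - (u + (n : ℤ)) = -n by ring]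
  simp [coeffInt]

/-- The sum defining `JCoeff u` is the product of the two bilateral series, where the index `n`
corresponds to the mode `u + n` of `Q_X(z)`. -/
lemma hasSum_JTerm (u : ℤ) : HasSum (JTerm u) (bilJ evX evY u) := by
  have h := (summable_conv hx.adm_qq hy.adm_sg_qq_neg u).hasSum
  have hinj : Function.Injective fun n : ℕ => u + (n : ℤ) := fun a b hab => by
    simpa using hab
  rw [← hinj.hasSum_iff] at h
  · rwa [funext fun n => JTerm_eq hx hy u n]
  · intro m hm
    have : m - u < 0 := by
      by_contra hn
      exact hm ⟨(m - u).toNat, by simp only; omega⟩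
    rw [show -(u - m) = m - u by ring, qq_of_neg this]
    simp

lemma KTerm_eq (u v : ℤ) (n : ℕ) : KTerm u v n =
    kap n * (bilJ evX evY (u + n) * bilJ evX evY (v - n)) := by
  have h := fun u => (hasSum_JTerm hx hy u).tsum_eq
  rw [KTerm, JCoeff, JCoeff, h, h, kernelCoeff_eq, map_intCast]

lemma summable_KTerm (u v : ℤ) : Summable (KTerm u v) :=
  (summable_kap_mul (adm_bilJ hx hy) u v).congr fun n => (KTerm_eq hx hy u v n).symm

lemma kernelK_eq (u v : ℤ) :
    kernelK u v = MvPowerSeries.C (eps u v * (1 / 2)) * twoPoint evX evY u v := by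
  rw [kernelK, tsum_congr (KTerm_eq hx hy u v)]
  rfl

/-- The pairing of the nested word is a multiple of the sum of the weights of all strict partitions
containing the given parts. -/
lemma pairing_nested (l : List ℕ+) (hl : l.Nodup) :
    pairing evX evY (nested (l.map fun m : ℕ+ => (m : ℤ))) [] =
      (((l.map fun m : ℕ+ => 2 * sg (m : ℤ)).prod : ℤ) : SeriesXY) *
        ∑' lam : {lam : StrictPartition | l.toFinset ⊆ lam}, weight lam := by
  classical
  have hs : Summable ({lam : StrictPartition | l.toFinset ⊆ lam}.indicator weight) :=
    summable_of_lo (fun lam => (word lam).sum) (fun lam => by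
      rw [Set.indicator_apply]
      split_ifs
      · rw [weight_eq hx hy]
        refine lo_pairTerm hx hy _ _ lam _ fun _ _ => ?_
        have := sum_word_nonneg lam
        simp only [List.sum_nil]; omega
      · exact lo_zero _) finite_sum_word_le
  rw [tsum_subtype, ← hs.tsum_mul_left]
  refine tsum_congr fun lam => ?_
  have h := (isVacuumState_qState evX).nested_word l hl lam []
  rw [List.nil_append, List.nil_append] at h
  rw [pairTerm, h, Set.indicator_apply]
  have e : (∀ k ∈ l, k ∈ lam) ↔ lam ∈ {lam : StrictPartition | l.toFinset ⊆ lam} := by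
    simp [Finset.subset_iff]
  simp only [e]
  split_ifs
  · rw [weight_eq hx hy, pairTerm, List.nil_append]; ring
  · ring

lemma corr_eq_pfaffian (N : ℕ) (k : Fin N → ℕ+) (hk : Function.Injective k) :
    corr (Finset.univ.image k) = pfaffian N (matrixM k) := by
  have hne : MvPowerSeries.constantCoeff normConst ≠ 0 := by
    rw [constantCoeff_normConst hx hy]; exact one_ne_zero
  have hl : (List.ofFn k).Nodup := List.nodup_ofFn.2 hk
  have hA : (List.ofFn k).toFinset = Finset.univ.image k := by ext; simp
  have h1 := pairing_ofFn hx hy (MvPowerSeries.C (1 / 2)) halfSign N (signedSeq k) (matrixM k)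
    fun i j hij => by
      rw [matrixM, if_pos hij, kernelK_eq hx hy, map_mul, C_eps]
      · ring
      · simp only [signedSeq]
        have h2 : ∀ m : ℕ+, (0 : ℤ) < m := fun m => by exact_mod_cast m.pos
        split_ifs with h3 h4
        · exact Or.inl (h2 _)
        · exact Or.inl (h2 _)
        · rw [Fin.lt_def] at hij; omega
        · exact Or.inr (neg_lt_zero.2 (h2 _))
  have h2 := prod_halfSign_nested (List.ofFn k)
  have h3 : ∏ i, halfSign (signedSeq k i) =
      ((nested ((List.ofFn k).map fun m : ℕ+ => (m : ℤ))).map halfSign).prod := by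
    rw [← ofFn_signedSeq, List.map_ofFn, List.prod_ofFn]; rfl
  have hS : Summable fun lam : {lam : StrictPartition | Finset.univ.image k ⊆ lam} => weight lam := by
    exact summable_of_lo (fun lam => (word lam.1).sum) (fun lam => by
      rw [weight_eq hx hy]
      refine lo_pairTerm hx hy _ _ lam.1 _ fun _ _ => ?_
      have := sum_word_nonneg lam.1
      simp only [List.sum_nil]; omega)
      fun n => Set.Finite.preimage (f := Subtype.val) Subtype.val_injective.injOn
        (finite_sum_word_le n)
  rw [ofFn_signedSeq, h3, pairing_nested hx hy _ hl, hA, ← normConst_eq hx hy] at h1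
  rw [List.length_ofFn] at h2
  have h4 : (MvPowerSeries.C (1 / 2 : ℚ) : SeriesXY) ^ N * 2 ^ N = 1 := by
    rw [← mul_pow, one_div, C_inv_two_mul_two, one_pow]
  have h5 : ∑' lam : {lam : StrictPartition | Finset.univ.image k ⊆ lam}, weight lam =
      normConst * pfaffian N (matrixM k) := by
    rw [← h1]
    linear_combination (-∑' lam : {lam : StrictPartition | Finset.univ.image k ⊆ lam},
      weight lam) * (h4 + (MvPowerSeries.C (1 / 2 : ℚ) : SeriesXY) ^ N * h2)
  rw [corr, shiftedSchurMeasure, hS.tsum_mul_left, h5, ← mul_assoc, MvPowerSeries.inv_mul_cancel _ hne,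
    one_mul]

end

end

end ShiftedSchur

theorem theorem3p1 :
    (∀ lam : ShiftedSchur.StrictPartition,
      Summable (ShiftedSchur.schurQTerm ShiftedSchur.varX (ShiftedSchur.part lam)) ∧
      Summable (ShiftedSchur.schurQTerm ShiftedSchur.varY (ShiftedSchur.part lam))) ∧
    Summable ShiftedSchur.weight ∧
    IsUnit ShiftedSchur.normConst ∧
    (∀ u : ℤ, Summable (ShiftedSchur.JTerm u)) ∧
    (∀ u v : ℤ, Summable (ShiftedSchur.KTerm u v)) ∧
    ∀ (N : ℕ) (k : Fin N → ℕ+), Function.Injective k →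
      ShiftedSchur.corr (Finset.univ.image k) =
        ShiftedSchur.pfaffian N (ShiftedSchur.matrixM k) := by
  obtain ⟨evX, hx⟩ := ShiftedSchur.exists_isSpecialization Sum.inl Sum.inl_injective
  obtain ⟨evY, hy⟩ := ShiftedSchur.exists_isSpecialization Sum.inr Sum.inr_injective
  exact ⟨fun lam => ⟨hx.summable_schurQTerm _, hy.summable_schurQTerm _⟩,
    ShiftedSchur.summable_weight hx hy, ShiftedSchur.isUnit_normConst hx hy,
    fun u => (ShiftedSchur.hasSum_JTerm hx hy u).summable,
    ShiftedSchur.summable_KTerm hx hy, ShiftedSchur.corr_eq_pfaffian hx hy⟩
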